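/- Let $H$ be a complex Hilbert space and let $\mathcal L(H)$ be the algebra of bounded linear operators on $H$. A finite-dimensional complex Lie algebra $L$ acts on the right on $H$ if it is given with a Lie homomorphism $\rho$ into $\mathcal L(H)$ with the opposite product; write $e\,x=\rho(x)e$, so that $e[x,y]=(e\,x)y-(e\,y)x$. A Lie algebra of operators on $H$ is a Lie subalgebra of $\mathcal L(H)$ with the opposite product, acting by inclusion. For a character $f$ of $L$ (a linear form $f\in L^*$ with $f([x,y])=0$ for all $x,y\in L$), the Koszul complex $(H\otimes\bigwedge L,d(f))$ has the differentials $d_p(f)\colon H\otimes\bigwedge^pL\to H\otimes\bigwedge^{p-1}L$, $$d_p(f)\,e\langle x_1\wedge\dots\wedge x_p\rangle=\sum_{k=1}^p(-1)^{k+1}e(x_k-f(x_k))\langle x_1\wedge\dots\wedge\hat x_k\wedge\dots\wedge x_p\rangle+\sum_{1\le k<l\le p}(-1)^{k+l}e\langle[x_k,x_l]\wedge x_1\wedge\dots\wedge\hat x_k\wedge\dots\wedge\hat x_l\wedge\dots\wedge x_p\rangle,$$ where $e\langle\omega\rangle$ denotes $e\otimes\omega$ and a hat means deletion, and $d_0(f)=0$.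 The joint spectrum is $$Sp(L,H)=\{f\in L^*: f \text{ is a character of } L \text{ and } H_*(H\otimes\textstyle\bigwedge L,d(f))\ne0\}.$$ **Theorem.** Let $H_1,H_2$ be complex Hilbert spaces, and let $L_1,L_2$ be solvable finite-dimensional complex Lie algebras of operators on $H_1$ and $H_2$. Let $H_1\overline\otimes H_2$ be the completion of $H_1\otimes H_2$ for the canonical scalar product. (a) Let the direct product $L_1\times L_2$ act on $H_1\overline\otimes H_2$ by $(x,y)\mapsto x\otimes1+1\otimes y$. Under the natural identification $\tilde K\colon(L_1\times L_2)^*\cong L_1^*\times L_2^*$, $\tilde K(f)=(f\circ i_1,f\circ i_2)$, where $i_j\colon L_j\to L_1\times L_2$ are the canonical inclusions, $$Sp(L_1\times L_2,H_1\overline\otimes H_2)=Sp(L_1,H_1)\times Sp(L_2,H_2).$$ (b) The same equality holds when $L_1\times L_2$ is read as the Lie algebra of operators $M=\{x\otimes1+1\otimes y:x\in L_1,\ y\in L_2\}$ on $H_1\overline\otimes H_2$: the image of $Sp(M,H_1\overline\otimes H_2)$ under the map $f\mapsto\bigl((x\mapsto f(x\otimes1)),(y\mapsto f(1\otimes y))\bigr)$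 is $Sp(L_1,H_1)\times Sp(L_2,H_2)$. -/

import Mathlib

open scoped TensorProduct

attribute [local instance 100] LieRing.ofAssociativeRing

noncomputable section

/-! ### The Koszul complex and the joint spectrum

For a Lie algebra `L` acting on the right on `H` (through a Lie homomorphism `ρ` into the bounded
operators with the opposite product, `e x = (ρ x).unop e`) and `f : L → ℂ` linear, the Koszul
complex has the spaces `H ⊗ ⋀ᵖ L`. -/

namespace LieSpectrum

variable {L : Type*} [LieRing L] [LieAlgebra ℂ L]
  {H : Type*} [NormedAddCommGroup H] [InnerProductSpace ℂ H]

/-- The operator `e ↦ e (x - f x)` on `H`, depending linearly on `x`. -/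
def shift (ρ : L →ₗ⁅ℂ⁆ (H →L[ℂ] H)ᵐᵒᵖ) (f : Module.Dual ℂ L) : L →ₗ[ℂ] (H →ₗ[ℂ] H) where
  toFun x := ((ρ x).unop : H →ₗ[ℂ] H) - f x • LinearMap.id
  map_add' x y := by
    ext e
    simp only [map_add, MulOpposite.unop_add, LinearMap.sub_apply, LinearMap.add_apply,
      ContinuousLinearMap.coe_coe, add_apply, LinearMap.smul_apply,
      LinearMap.id_apply, add_smul]
    abel
  map_smul' c x := by
    ext e
    simp [smul_sub, mul_smul]

/-- For fixed `ω`, the map `e ↦ e ⊗ ω`, depending linearly on `ω`. -/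
def insertRight (H : Type*) [NormedAddCommGroup H] [InnerProductSpace ℂ H]
    (L : Type*) [LieRing L] [LieAlgebra ℂ L] (p : ℕ) :
    ⋀[ℂ]^p L →ₗ[ℂ] (H →ₗ[ℂ] H ⊗[ℂ] ⋀[ℂ]^p L) :=
  (TensorProduct.mk ℂ H (⋀[ℂ]^p L)).flip

/-- The first sum in the Koszul differential, as an alternating map of `x₁, …, xₚ₊₁`. -/
def actionTerm (ρ : L →ₗ⁅ℂ⁆ (H →L[ℂ] H)ᵐᵒᵖ) (f : Module.Dual ℂ L) (p : ℕ) :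
    L [⋀^Fin (p + 1)]→ₗ[ℂ] (H →ₗ[ℂ] H ⊗[ℂ] ⋀[ℂ]^p L) :=
  AlternatingMap.alternatizeUncurryFin
    { toFun := fun x =>
        ((LinearMap.lcomp ℂ (H ⊗[ℂ] ⋀[ℂ]^p L) (shift ρ f x)) ∘ₗ insertRight H L p).compAlternatingMap
          (exteriorPower.ιMulti ℂ p)
      map_add' := by
        intro x y
        ext v e
        simp [insertRight]
      map_smul' := by
        intro c x
        ext v e
        simp [insertRight, TensorProduct.smul_tmul'] }

/-- The map sending `x`, `y` and `w₁, …, w_q` to `e ↦ e ⊗ ([x, y] ∧ w₁ ∧ … ∧ w_q)`. -/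
def bracketForm (H : Type*) [NormedAddCommGroup H] [InnerProductSpace ℂ H]
    (L : Type*) [LieRing L] [LieAlgebra ℂ L] (q : ℕ) :
    L →ₗ[ℂ] L →ₗ[ℂ] L [⋀^Fin q]→ₗ[ℂ] (H →ₗ[ℂ] H ⊗[ℂ] ⋀[ℂ]^(q + 1) L) :=
  (LieModule.toEnd ℂ L L : L →ₗ[ℂ] L →ₗ[ℂ] L).compr₂
    (((insertRight H L (q + 1)).compAlternatingMap (exteriorPower.ιMulti ℂ (q + 1))).curryLeft)

/-- The second sum in the Koszul differential, as an alternating map of `x₁, …, xₚ₊₁`. Alternating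
the bracket twice counts every pair `k < l` twice, hence the factor `1/2`; the resulting formula is
`koszulD_apply_succ`. -/
def bracketTerm (H : Type*) [NormedAddCommGroup H] [InnerProductSpace ℂ H]
    (L : Type*) [LieRing L] [LieAlgebra ℂ L] :
    (p : ℕ) → L [⋀^Fin (p + 1)]→ₗ[ℂ] (H →ₗ[ℂ] H ⊗[ℂ] ⋀[ℂ]^p L)
  | 0 => 0
  | q + 1 => (-(1 / 2 : ℂ)) • AlternatingMap.alternatizeUncurryFin
      (AlternatingMap.alternatizeUncurryFinLM ∘ₗ bracketForm H L q)

/-- The Koszul differential `d_{p+1}(f) : H ⊗ ⋀ᵖ⁺¹ L → H ⊗ ⋀ᵖ L`. -/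
def koszulD (ρ : L →ₗ⁅ℂ⁆ (H →L[ℂ] H)ᵐᵒᵖ) (f : Module.Dual ℂ L) (p : ℕ) :
    H ⊗[ℂ] ⋀[ℂ]^(p + 1) L →ₗ[ℂ] H ⊗[ℂ] ⋀[ℂ]^p L :=
  TensorProduct.lift
    (exteriorPower.alternatingMapLinearEquiv (actionTerm ρ f p + bracketTerm H L p)).flip

/-- `d₁(f) (e ⟨x⟩) = e (x - f x)`. -/
theorem koszulD_apply_zero (ρ : L →ₗ⁅ℂ⁆ (H →L[ℂ] H)ᵐᵒᵖ) (f : Module.Dual ℂ L)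
    (e : H) (x : Fin 1 → L) :
    koszulD ρ f 0 (e ⊗ₜ exteriorPower.ιMulti ℂ 1 x) =
      ((ρ (x 0)).unop e - f (x 0) • e) ⊗ₜ exteriorPower.ιMulti ℂ 0 ((0 : Fin 1).removeNth x) := by
  simp [koszulD, actionTerm, bracketTerm, insertRight, shift, TensorProduct.sub_tmul,
    TensorProduct.smul_tmul', AlternatingMap.alternatizeUncurryFin_apply, exteriorPower.alternatingMapLinearEquiv_apply_ιMulti]

/-- The formula for the Koszul differential,
`d(f) (e ⟨x₁ ∧ … ∧ xₚ⟩) = ∑ₖ (-1)ᵏ⁺¹ e (xₖ - f xₖ) ⟨… x̂ₖ …⟩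
  + ∑_{k < l} (-1)ᵏ⁺ˡ e ⟨[xₖ, xₗ] ∧ … x̂ₖ … x̂ₗ …⟩`, with `p = q + 2`. Indices start at `0` here,
and a pair `k < l` is written as `(i, j + 1)` with `i ≤ j`, which accounts for the signs. -/
theorem koszulD_apply_succ (ρ : L →ₗ⁅ℂ⁆ (H →L[ℂ] H)ᵐᵒᵖ) (f : Module.Dual ℂ L) (q : ℕ)
    (e : H) (x : Fin (q + 2) → L) :
    koszulD ρ f (q + 1) (e ⊗ₜ exteriorPower.ιMulti ℂ (q + 2) x) =
      ∑ k : Fin (q + 2), (-1 : ℤ) ^ (k : ℕ) •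
        (((ρ (x k)).unop e - f (x k) • e) ⊗ₜ[ℂ] exteriorPower.ιMulti ℂ (q + 1) (k.removeNth x)) +
      ∑ i : Fin (q + 1), ∑ j ≥ i, (-1 : ℤ) ^ (i + j + 1 : ℕ) •
        (e ⊗ₜ[ℂ] exteriorPower.ιMulti ℂ (q + 1)
          (Matrix.vecCons ⁅x i.castSucc, x j.succ⁆ (j.removeNth (i.castSucc.removeNth x)))) := by
  have key : ∀ a b : L, ∀ w : Fin q → L, bracketForm H L q a b w e =
      e ⊗ₜ[ℂ] exteriorPower.ιMulti ℂ (q + 1) (Matrix.vecCons ⁅a, b⁆ w) := by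
    intro a b w
    rfl
  have anti : ∀ a b : L, ∀ w : Fin q → L, bracketForm H L q b a w = - bracketForm H L q a b w := by
    intro a b w
    ext u
    have h := (exteriorPower.ιMulti ℂ (q + 1)).map_update_neg (Matrix.vecCons ⁅a, b⁆ w) 0 ⁅a, b⁆
    rw [lie_skew, Matrix.vecCons, Fin.update_cons_zero, Fin.update_cons_zero] at h
    exact (congrArg (fun z => u ⊗ₜ[ℂ] z) h).trans (TensorProduct.tmul_neg _ _)
  have hA : (AlternatingMap.alternatizeUncurryFin
      (AlternatingMap.alternatizeUncurryFinLM ∘ₗ bracketForm H L q) x) e =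
      ∑ i : Fin (q + 1), ∑ j ≥ i, (-1 : ℤ) ^ (i + j : ℕ) • ((2 : ℂ) •
        (e ⊗ₜ[ℂ] exteriorPower.ιMulti ℂ (q + 1)
          (Matrix.vecCons ⁅x i.castSucc, x j.succ⁆ (j.removeNth (i.castSucc.removeNth x))))) := by
    rw [AlternatingMap.alternatizeUncurryFin_alternatizeUncurryFinLM_comp_apply]
    simp only [LinearMap.sum_apply, LinearMap.smul_apply, anti (x (Fin.castSucc _)), sub_neg_eq_add,
      LinearMap.add_apply, key, two_smul]
  have hB : bracketTerm H L (q + 1) x e =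
      ∑ i : Fin (q + 1), ∑ j ≥ i, (-1 : ℤ) ^ (i + j + 1 : ℕ) •
        (e ⊗ₜ[ℂ] exteriorPower.ιMulti ℂ (q + 1)
          (Matrix.vecCons ⁅x i.castSucc, x j.succ⁆ (j.removeNth (i.castSucc.removeNth x)))) := by
    simp only [bracketTerm, AlternatingMap.smul_apply, LinearMap.smul_apply, hA, Finset.smul_sum]
    refine Finset.sum_congr rfl fun i _ => Finset.sum_congr rfl fun j _ => ?_
    rw [smul_comm (-(1 / 2 : ℂ)), smul_smul, pow_succ, mul_smul]
    simp only [smul_smul]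
    norm_num
  have hC : actionTerm ρ f (q + 1) x e = ∑ k : Fin (q + 2), (-1 : ℤ) ^ (k : ℕ) •
        (((ρ (x k)).unop e - f (x k) • e) ⊗ₜ[ℂ]
          exteriorPower.ιMulti ℂ (q + 1) (k.removeNth x)) := by
    simp only [actionTerm, AlternatingMap.alternatizeUncurryFin_apply, LinearMap.sum_apply]
    refine Finset.sum_congr rfl fun k _ => ?_
    rcases Nat.even_or_odd (k : ℕ) with h | h <;>
      simp [h.neg_one_pow, insertRight, shift, TensorProduct.sub_tmul, TensorProduct.smul_tmul']
  rw [← hB, ← hC]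
  simp [koszulD, exteriorPower.alternatingMapLinearEquiv_apply_ιMulti]

/-- The cycles of degree `p`; the differential in degree `0` is zero. -/
def koszulCycles (ρ : L →ₗ⁅ℂ⁆ (H →L[ℂ] H)ᵐᵒᵖ) (f : Module.Dual ℂ L) :
    (p : ℕ) → Submodule ℂ (H ⊗[ℂ] ⋀[ℂ]^p L)
  | 0 => ⊤
  | p + 1 => LinearMap.ker (koszulD ρ f p)

/-- The homology `H_p(H ⊗ ⋀ L, d(f))`: cycles modulo boundaries. -/
abbrev koszulHomology (ρ : L →ₗ⁅ℂ⁆ (H →L[ℂ] H)ᵐᵒᵖ) (f : Module.Dual ℂ L) (p : ℕ) : Type _ :=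
  koszulCycles ρ f p ⧸ (LinearMap.range (koszulD ρ f p)).submoduleOf (koszulCycles ρ f p)

/-- The joint spectrum of a Lie algebra acting on `H` from the right: the characters `f` for which
the Koszul complex has nonzero homology. -/
def jointSpectrum (ρ : L →ₗ⁅ℂ⁆ (H →L[ℂ] H)ᵐᵒᵖ) : Set (Module.Dual ℂ L) :=
  {f | (∀ x y : L, f ⁅x, y⁆ = 0) ∧ ∃ p : ℕ, Nontrivial (koszulHomology ρ f p)}

/-- `Sp(L, H)` for a Lie algebra `L` of bounded operators on `H` (with the opposite product). -/
def Sp (L : LieSubalgebra ℂ (H →L[ℂ] H)ᵐᵒᵖ) : Set (Module.Dual ℂ L) :=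
  jointSpectrum L.incl

/-! ### The direct product acting on the Hilbert tensor product -/

variable (H₁ H₂ : Type*) [NormedAddCommGroup H₁] [InnerProductSpace ℂ H₁]
  [NormedAddCommGroup H₂] [InnerProductSpace ℂ H₂]

/-- The completion of the tensor product for the canonical scalar product. -/
abbrev HilbertTensor : Type _ := UniformSpace.Completion (H₁ ⊗[ℂ] H₂)

variable {H₁ H₂}

variable (H₂) in
/-- The operator `a ⊗ 1`. -/
def tensorOne (a : H₁ →L[ℂ] H₁) : HilbertTensor H₁ H₂ →L[ℂ] HilbertTensor H₁ H₂ :=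
  (a.rTensor H₂).completion

variable (H₁) in
/-- The operator `1 ⊗ b`. -/
def oneTensor (b : H₂ →L[ℂ] H₂) : HilbertTensor H₁ H₂ →L[ℂ] HilbertTensor H₁ H₂ :=
  (b.lTensor H₁).completion

theorem tensorOne_coe (a : H₁ →L[ℂ] H₁) (t : H₁ ⊗[ℂ] H₂) :
    tensorOne H₂ a (t : HilbertTensor H₁ H₂) = (a.rTensor H₂ t : H₁ ⊗[ℂ] H₂) :=
  ContinuousLinearMap.completion_apply_coe _ _

theorem oneTensor_coe (b : H₂ →L[ℂ] H₂) (t : H₁ ⊗[ℂ] H₂) :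
    oneTensor H₁ b (t : HilbertTensor H₁ H₂) = (b.lTensor H₁ t : H₁ ⊗[ℂ] H₂) :=
  ContinuousLinearMap.completion_apply_coe _ _

theorem hilbertTensor_ext {S T : HilbertTensor H₁ H₂ →L[ℂ] HilbertTensor H₁ H₂}
    (h : ∀ t : H₁ ⊗[ℂ] H₂, S (t : HilbertTensor H₁ H₂) = T (t : HilbertTensor H₁ H₂)) : S = T := by
  ext u
  induction u using UniformSpace.Completion.induction_on with
  | hp => exact isClosed_eq S.continuous T.continuous
  | ih t => exact h t

theorem tensorOne_add (a b : H₁ →L[ℂ] H₁) :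
    tensorOne H₂ (a + b) = tensorOne H₂ a + tensorOne H₂ b :=
  hilbertTensor_ext fun t => by
    simp only [tensorOne_coe, ContinuousLinearMap.rTensor_add, add_apply,
      UniformSpace.Completion.coe_add]

theorem tensorOne_sub (a b : H₁ →L[ℂ] H₁) :
    tensorOne H₂ (a - b) = tensorOne H₂ a - tensorOne H₂ b :=
  hilbertTensor_ext fun t => by
    simp only [tensorOne_coe, ContinuousLinearMap.rTensor_sub, sub_apply,
      UniformSpace.Completion.coe_sub]

theorem tensorOne_smul (c : ℂ) (a : H₁ →L[ℂ] H₁) :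
    tensorOne H₂ (c • a) = c • tensorOne H₂ a :=
  hilbertTensor_ext fun t => by
    simp only [tensorOne_coe, ContinuousLinearMap.rTensor_smul, smul_apply,
      UniformSpace.Completion.coe_smul]

theorem tensorOne_mul (a b : H₁ →L[ℂ] H₁) :
    tensorOne H₂ (a * b) = tensorOne H₂ a * tensorOne H₂ b :=
  hilbertTensor_ext fun t => by
    simp only [mul_apply_eq_comp, tensorOne_coe, ContinuousLinearMap.rTensor_mul]

theorem oneTensor_add (a b : H₂ →L[ℂ] H₂) :
    oneTensor H₁ (a + b) = oneTensor H₁ a + oneTensor H₁ b :=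
  hilbertTensor_ext fun t => by
    simp only [oneTensor_coe, ContinuousLinearMap.lTensor_add, add_apply,
      UniformSpace.Completion.coe_add]

theorem oneTensor_sub (a b : H₂ →L[ℂ] H₂) :
    oneTensor H₁ (a - b) = oneTensor H₁ a - oneTensor H₁ b :=
  hilbertTensor_ext fun t => by
    simp only [oneTensor_coe, ContinuousLinearMap.lTensor_sub, sub_apply,
      UniformSpace.Completion.coe_sub]

theorem oneTensor_smul (c : ℂ) (a : H₂ →L[ℂ] H₂) :
    oneTensor H₁ (c • a) = c • oneTensor H₁ a :=
  hilbertTensor_ext fun t => by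
    simp only [oneTensor_coe, ContinuousLinearMap.lTensor_smul, smul_apply,
      UniformSpace.Completion.coe_smul]

theorem oneTensor_mul (a b : H₂ →L[ℂ] H₂) :
    oneTensor H₁ (a * b) = oneTensor H₁ a * oneTensor H₁ b :=
  hilbertTensor_ext fun t => by
    simp only [mul_apply_eq_comp, oneTensor_coe, ContinuousLinearMap.lTensor_mul]

theorem oneTensor_mul_tensorOne (a : H₁ →L[ℂ] H₁) (b : H₂ →L[ℂ] H₂) :
    oneTensor H₁ b * tensorOne H₂ a = tensorOne H₂ a * oneTensor H₁ b :=
  hilbertTensor_ext fun t => by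
    simp only [mul_apply_eq_comp, oneTensor_coe, tensorOne_coe]
    congr 1
    simp only [ContinuousLinearMap.rTensor_apply, ContinuousLinearMap.lTensor_apply,
      ← LinearMap.comp_apply, LinearMap.lTensor_comp_rTensor, LinearMap.rTensor_comp_lTensor]

/-- The action `(x, y) ↦ x ⊗ 1 + 1 ⊗ y` of the direct product `L₁ × L₂` on the Hilbert tensor
product. -/
def productAction (L₁ : LieSubalgebra ℂ (H₁ →L[ℂ] H₁)ᵐᵒᵖ) (L₂ : LieSubalgebra ℂ (H₂ →L[ℂ] H₂)ᵐᵒᵖ) :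
    L₁ × L₂ →ₗ⁅ℂ⁆ (HilbertTensor H₁ H₂ →L[ℂ] HilbertTensor H₁ H₂)ᵐᵒᵖ where
  toFun z := MulOpposite.op (tensorOne H₂ z.1.1.unop + oneTensor H₁ z.2.1.unop)
  map_add' z w := by
    simp only [Prod.fst_add, Prod.snd_add, AddMemClass.coe_add, MulOpposite.unop_add,
      tensorOne_add, oneTensor_add, ← MulOpposite.op_add]
    congr 1
    abel
  map_smul' c z := by
    simp only [Prod.smul_fst, Prod.smul_snd, SetLike.val_smul, MulOpposite.unop_smul,
      tensorOne_smul, oneTensor_smul, ← smul_add, MulOpposite.op_smul, RingHom.id_apply]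
  map_lie' {z w} := by
    simp only [LieAlgebra.Prod.bracket_apply, LieSubalgebra.coe_bracket, LieRing.of_associative_ring_bracket,
      MulOpposite.unop_sub, MulOpposite.unop_mul, tensorOne_sub, oneTensor_sub, tensorOne_mul,
      oneTensor_mul, ← MulOpposite.op_mul, ← MulOpposite.op_sub]
    congr 1
    simp only [mul_add, add_mul, oneTensor_mul_tensorOne]
    abel

/-- The Lie algebra of operators `{x ⊗ 1 + 1 ⊗ y : x ∈ L₁, y ∈ L₂}`. -/
def productAlgebra (L₁ : LieSubalgebra ℂ (H₁ →L[ℂ] H₁)ᵐᵒᵖ)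
    (L₂ : LieSubalgebra ℂ (H₂ →L[ℂ] H₂)ᵐᵒᵖ) :
    LieSubalgebra ℂ (HilbertTensor H₁ H₂ →L[ℂ] HilbertTensor H₁ H₂)ᵐᵒᵖ :=
  (productAction L₁ L₂).range

theorem mem_productAlgebra (L₁ : LieSubalgebra ℂ (H₁ →L[ℂ] H₁)ᵐᵒᵖ)
    (L₂ : LieSubalgebra ℂ (H₂ →L[ℂ] H₂)ᵐᵒᵖ)
    (T : (HilbertTensor H₁ H₂ →L[ℂ] HilbertTensor H₁ H₂)ᵐᵒᵖ) :
    T ∈ productAlgebra L₁ L₂ ↔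
      ∃ x ∈ L₁, ∃ y ∈ L₂, tensorOne H₂ x.unop + oneTensor H₁ y.unop = T.unop := by
  constructor
  · rintro ⟨⟨x, y⟩, rfl⟩
    exact ⟨x, x.2, y, y.2, rfl⟩
  · rintro ⟨x, hx, y, hy, h⟩
    exact ⟨(⟨x, hx⟩, ⟨y, hy⟩), congrArg MulOpposite.op h⟩

/-- The inclusion `x ↦ x ⊗ 1` of `L₁`. -/
def inclLeft (L₁ : LieSubalgebra ℂ (H₁ →L[ℂ] H₁)ᵐᵒᵖ) (L₂ : LieSubalgebra ℂ (H₂ →L[ℂ] H₂)ᵐᵒᵖ) :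
    L₁ →ₗ[ℂ] productAlgebra L₁ L₂ :=
  ((productAction L₁ L₂).rangeRestrict : L₁ × L₂ →ₗ[ℂ] (productAction L₁ L₂).range) ∘ₗ
    LinearMap.inl ℂ L₁ L₂

/-- The inclusion `y ↦ 1 ⊗ y` of `L₂`. -/
def inclRight (L₁ : LieSubalgebra ℂ (H₁ →L[ℂ] H₁)ᵐᵒᵖ) (L₂ : LieSubalgebra ℂ (H₂ →L[ℂ] H₂)ᵐᵒᵖ) :
    L₂ →ₗ[ℂ] productAlgebra L₁ L₂ :=
  ((productAction L₁ L₂).rangeRestrict : L₁ × L₂ →ₗ[ℂ] (productAction L₁ L₂).range) ∘ₗ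
    LinearMap.inr ℂ L₁ L₂

theorem inclLeft_coe (L₁ : LieSubalgebra ℂ (H₁ →L[ℂ] H₁)ᵐᵒᵖ)
    (L₂ : LieSubalgebra ℂ (H₂ →L[ℂ] H₂)ᵐᵒᵖ) (x : L₁) :
    (inclLeft L₁ L₂ x).1.unop = tensorOne H₂ x.1.unop := by
  refine (show _ = tensorOne H₂ x.1.unop + oneTensor H₁ 0 from rfl).trans ?_
  rw [← zero_smul ℂ (0 : H₂ →L[ℂ] H₂), oneTensor_smul, zero_smul, add_zero]

theorem inclRight_coe (L₁ : LieSubalgebra ℂ (H₁ →L[ℂ] H₁)ᵐᵒᵖ)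
    (L₂ : LieSubalgebra ℂ (H₂ →L[ℂ] H₂)ᵐᵒᵖ) (y : L₂) :
    (inclRight L₁ L₂ y).1.unop = oneTensor H₁ y.1.unop := by
  refine (show _ = tensorOne H₂ 0 + oneTensor H₁ y.1.unop from rfl).trans ?_
  rw [← zero_smul ℂ (0 : H₁ →L[ℂ] H₁), tensorOne_smul, zero_smul, zero_add]

end LieSpectrum

end

/-! All degrees of a Koszul complex are collected into one operator `totalDiff` on `H ⊗ ⋀L`. It
lowers degree by one, so some homology group is nonzero exactly when this operator has a cycle that
is not a boundary (`mem_jointSpectrum_iff`). Its algebra follows from Cartan's formula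
`totalDiff_wedge`: the anticommutator of `totalDiff` with `x ∧` is the Lie derivative along `x`.

For (a), `⋀(L₁ × L₂) = ⋀L₁ ⊗ ⋀L₂` turns the Koszul complex of the product into the Hilbert tensor
product of the two complexes, with differential `d ⊗ 1 + ε ⊗ d'` for the parity operator `ε`. What
remains is a Künneth statement, `selfExact_tensorDiff_iff`. If one factor is exact, the open mapping
theorem gives it a bounded contracting homotopy, which can be tensored with the other factor.
Conversely, exactness of a Hilbert differential `d` is equivalent to an estimate `‖x‖ ≤ C (‖d x‖ +
‖d* x‖)`. If neither factor is exact, each has unit vectors `u`, `v` almost killed by the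
differential and its adjoint; then `u ⊗ v` is almost killed by the tensor differential and its
adjoint, so the tensor product is not exact. A character of the product is a pair of characters, and
(a) follows.

For (b), the operator algebra `M` is the quotient of `L₁ × L₂` by the kernel of its action. If `x ⊗
1 + 1 ⊗ y = 0` on nonzero spaces, then `x = c` and `y = -c` are scalars, so the kernel is zero or is
spanned by the central element `z = (1, -1)`. A spectral point `f` takes the value `c` on any
central element acting as `c`, because otherwise wedging with that element is, up to a scalar, a
contracting homotopy. Hence `f` vanishes on the kernel, and `f(1 ⊗ 1) = 1` when `z` exists. The
character `(x, y) ↦ f(x ⊗ 1)` then has value 1 on `z`, so it splits `L₁ × L₂` as `M ⊕ ℂ z`. The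
complex of `L₁ × L₂` becomes two copies of that of `M`, and exactness of one is exactness of the
other (`SelfExact.of_retract`, `SelfExact.of_split_central`). -/

noncomputable section

namespace LieSpectrum

/-! ### Exactness of bounded differentials on Hilbert spaces: homotopies and estimates. -/

section HilbertComplexes

open ContinuousLinearMap TensorProduct

/-- A self-map `d` is exact if every `x` with `d x = 0` is of the form `d y`. -/
def SelfExact {X : Type*} [Zero X] (d : X → X) : Prop := ∀ x, d x = 0 → ∃ y, d y = x

section Hilbert

variable {X Y : Type*} [NormedAddCommGroup X] [InnerProductSpace ℂ X]
  [NormedAddCommGroup Y] [InnerProductSpace ℂ Y]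

/-- A bounded exact differential on a Hilbert space has a bounded contracting homotopy. -/
theorem exists_contraction [CompleteSpace X] (d : X →L[ℂ] X) (hd : ∀ x, d (d x) = 0)
    (hex : SelfExact d) : ∃ h : X →L[ℂ] X, ∀ x, d (h x) + h (d x) = x := by
  let K : Submodule ℂ X := d.ker
  have hK : IsClosed (K : Set X) := d.isClosed_ker
  have : CompleteSpace K := hK.completeSpace_coe
  have : CompleteSpace Kᗮ := K.isClosed_orthogonal.completeSpace_coe
  let T : Kᗮ →L[ℂ] K := (d ∘L Kᗮ.subtypeL).codRestrict K fun x => hd x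
  have hinj : T.ker = ⊥ := by
    refine LinearMap.ker_eq_bot'.mpr fun x hx => ?_
    have hxK : (x : X) ∈ K := congrArg Subtype.val hx
    have := Submodule.inner_right_of_mem_orthogonal hxK x.2
    exact Subtype.ext (inner_self_eq_zero.mp this)
  have hsurj : T.range = ⊤ := by
    refine LinearMap.range_eq_top.mpr fun y => ?_
    obtain ⟨w, hw⟩ := hex y y.2
    refine ⟨⟨w - K.starProjection w, K.sub_starProjection_mem_orthogonal w⟩, Subtype.ext ?_⟩
    have h0 : d (K.starProjection w) = 0 := (K.starProjection_apply_mem w : _ ∈ K)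
    change d (w - K.starProjection w) = y
    rw [map_sub, h0, sub_zero, hw]
  -- By the open mapping theorem, the bijection `d : Kᗮ → K` has a bounded inverse; the homotopy is
  -- this inverse after the orthogonal projection onto `K`.
  let e := ContinuousLinearEquiv.ofBijective T hinj hsurj
  refine ⟨Kᗮ.subtypeL ∘L (e.symm : K →L[ℂ] Kᗮ) ∘L K.orthogonalProjectionOnto, fun x => ?_⟩
  have h1 : ∀ y : K, d (e.symm y : Kᗮ) = y := fun y =>
    congrArg Subtype.val (e.apply_symm_apply y)
  have hdx : d x ∈ K := hd x
  have h2 : ((e.symm (⟨d x, hdx⟩ : K) : Kᗮ) : X) = x - K.starProjection x := by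
    have : e ⟨x - K.starProjection x, K.sub_starProjection_mem_orthogonal x⟩ = ⟨d x, hdx⟩ := by
      refine Subtype.ext ?_
      have h0 : d (K.starProjection x) = 0 := (K.starProjection_apply_mem x : _ ∈ K)
      change d (x - K.starProjection x) = d x
      rw [map_sub, h0, sub_zero]
    rw [← this, e.symm_apply_apply]
  have h3 : K.orthogonalProjectionOnto (d x) = ⟨d x, hdx⟩ :=
    K.orthogonalProjectionOnto_mem_subspace_eq_self ⟨d x, hdx⟩
  change d (e.symm (K.orthogonalProjectionOnto x) : Kᗮ) +
    (e.symm (K.orthogonalProjectionOnto (d x)) : Kᗮ) = x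
  rw [h1, h3, h2]
  change K.starProjection x + (x - K.starProjection x) = x
  abel

/-- A contracting homotopy bounds the norm by the differential and its adjoint. -/
theorem norm_le_of_contraction [CompleteSpace X] (d h : X →L[ℂ] X)
    (hh : ∀ x, d (h x) + h (d x) = x) (x : X) :
    ‖x‖ ≤ ‖h‖ * (‖d x‖ + ‖adjoint d x‖) := by
  rcases eq_or_ne x 0 with rfl | hx
  · simp
  have hx' : 0 < ‖x‖ := norm_pos_iff.mpr hx
  have h1 : ‖x‖ * ‖x‖ ≤ (‖h‖ * (‖d x‖ + ‖adjoint d x‖)) * ‖x‖ := by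
    -- Write one `x` in `⟨x, x⟩` as `d (h x) + h (d x)` and move the outer `d` to the other side as
    -- its adjoint.
    calc ‖x‖ * ‖x‖ = ‖(inner ℂ x x : ℂ)‖ := by
          rw [inner_self_eq_norm_sq_to_K]; simp [sq]
      _ = ‖(inner ℂ (adjoint d x) (h x) + inner ℂ x (h (d x)) : ℂ)‖ := by
          rw [adjoint_inner_left, ← inner_add_right, hh]
      _ ≤ ‖adjoint d x‖ * (‖h‖ * ‖x‖) + ‖x‖ * (‖h‖ * ‖d x‖) := by
          refine (norm_add_le _ _).trans (add_le_add ?_ ?_)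
          · exact (norm_inner_le_norm _ _).trans
              (mul_le_mul_of_nonneg_left (h.le_opNorm x) (norm_nonneg _))
          · exact (norm_inner_le_norm _ _).trans
              (mul_le_mul_of_nonneg_left (h.le_opNorm _) (norm_nonneg _))
      _ = _ := by ring
  exact le_of_mul_le_mul_right h1 hx'

/-- The converse of `exists_contraction` and `norm_le_of_contraction`. -/
theorem selfExact_of_norm_le [CompleteSpace X] (d : X →L[ℂ] X) (hd : ∀ x, d (d x) = 0) (C : ℝ)
    (hC : ∀ x, ‖x‖ ≤ C * (‖d x‖ + ‖adjoint d x‖)) : SelfExact d := by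
  -- `D` is self-adjoint, and since the ranges of `d` and `d*` are orthogonal, `‖D x‖² = ‖d x‖² +
  -- ‖d* x‖²`. The estimate therefore bounds `D` below, which makes it bijective.
  let D : X →L[ℂ] X := d + adjoint d
  have hd' : ∀ x, adjoint d (adjoint d x) = 0 := fun x => by
    refine ext_inner_right ℂ fun y => ?_
    rw [adjoint_inner_left, adjoint_inner_left, hd, inner_zero_right, inner_zero_left]
  have horth : ∀ x y, inner ℂ (d x) (adjoint d y) = (0 : ℂ) := fun x y => by
    rw [adjoint_inner_right, hd, inner_zero_left]
  have hpy : ∀ x, ‖D x‖ * ‖D x‖ = ‖d x‖ * ‖d x‖ + ‖adjoint d x‖ * ‖adjoint d x‖ := fun x =>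
    norm_add_sq_eq_norm_sq_add_norm_sq_of_inner_eq_zero _ _ (horth x x)
  have hb : ∀ x, ‖x‖ ≤ (2 * |C|) * ‖D x‖ := fun x => by
    have h1 : ‖d x‖ ≤ ‖D x‖ := by
      refine abs_le_of_sq_le_sq' ?_ (norm_nonneg _) |>.2
      nlinarith [hpy x, mul_self_nonneg ‖adjoint d x‖]
    have h2 : ‖adjoint d x‖ ≤ ‖D x‖ := by
      refine abs_le_of_sq_le_sq' ?_ (norm_nonneg _) |>.2
      nlinarith [hpy x, mul_self_nonneg ‖d x‖]
    calc ‖x‖ ≤ C * (‖d x‖ + ‖adjoint d x‖) := hC x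
      _ ≤ |C| * (‖d x‖ + ‖adjoint d x‖) :=
        mul_le_mul_of_nonneg_right (le_abs_self C) (by positivity)
      _ ≤ |C| * (‖D x‖ + ‖D x‖) :=
        mul_le_mul_of_nonneg_left (add_le_add h1 h2) (abs_nonneg C)
      _ = _ := by ring
  have hanti : AntilipschitzWith (2 * |C|).toNNReal D :=
    D.antilipschitz_of_bound fun x => by
      rw [Real.coe_toNNReal _ (by positivity)]; exact hb x
  have hclosed : IsClosed (D.range : Set X) := by
    rw [LinearMap.coe_range]
    exact hanti.isClosed_range D.uniformContinuous
  have : CompleteSpace D.range := hclosed.completeSpace_coe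
  have hDD : adjoint D = D := by simp [D, add_comm]
  have hrange : D.range = ⊤ := by
    rw [← Submodule.orthogonal_eq_bot_iff, ContinuousLinearMap.orthogonal_range, hDD]
    exact LinearMap.ker_eq_bot.mpr hanti.injective
  intro x hx
  obtain ⟨w, hw⟩ : ∃ w, D w = x := LinearMap.range_eq_top.mp hrange x
  refine ⟨w, ?_⟩
  -- Applying `d` to `x = d w + d* w` gives `d d* w = 0`, whence `‖d* w‖² = ⟨w, d d* w⟩ = 0`: the
  -- solution of `D w = x` already satisfies `d w = x`.
  have h0 : adjoint d w = 0 := by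
    have h1 : d (adjoint d w) = 0 := by
      have : d (d w + adjoint d w) = 0 := by rw [← hx, ← hw]; rfl
      simpa [hd] using this
    rw [← inner_self_eq_zero (𝕜 := ℂ), adjoint_inner_left, h1, inner_zero_right]
  have : d w + adjoint d w = x := hw
  rwa [h0, add_zero] at this

end Hilbert

/-! ### Bounded operators between Hilbert tensor products, and their adjoints. -/

section TensorMap

variable {X X' X'' Y Y' Y'' : Type*}
  [NormedAddCommGroup X] [InnerProductSpace ℂ X] [NormedAddCommGroup X'] [InnerProductSpace ℂ X']
  [NormedAddCommGroup X''] [InnerProductSpace ℂ X'']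
  [NormedAddCommGroup Y] [InnerProductSpace ℂ Y] [NormedAddCommGroup Y'] [InnerProductSpace ℂ Y']
  [NormedAddCommGroup Y''] [InnerProductSpace ℂ Y'']

/-- The bounded operator `f ⊗ g` between Hilbert tensor products. -/
def tensorMap (f : X →L[ℂ] X') (g : Y →L[ℂ] Y') : HilbertTensor X Y →L[ℂ] HilbertTensor X' Y' :=
  (mapL f g).completion

theorem tensorMap_coe (f : X →L[ℂ] X') (g : Y →L[ℂ] Y') (t : X ⊗[ℂ] Y) :
    tensorMap f g (t : HilbertTensor X Y) =
      (TensorProduct.map f.toLinearMap g.toLinearMap t : X' ⊗[ℂ] Y') := by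
  rw [tensorMap, completion_apply_coe, mapL_apply]

theorem hilbertTensor_ext_tmul {Z : Type*} [NormedAddCommGroup Z] [InnerProductSpace ℂ Z]
    {S T : HilbertTensor X Y →L[ℂ] Z}
    (h : ∀ x y, S ((x ⊗ₜ[ℂ] y : X ⊗[ℂ] Y) : HilbertTensor X Y) =
      T ((x ⊗ₜ[ℂ] y : X ⊗[ℂ] Y) : HilbertTensor X Y)) : S = T := by
  ext u
  induction u using UniformSpace.Completion.induction_on with
  | hp => exact isClosed_eq S.continuous T.continuous
  | ih t =>
    induction t with
    | zero => rw [UniformSpace.Completion.coe_zero, map_zero, map_zero]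
    | tmul x y => exact h x y
    | add a b ha hb => rw [UniformSpace.Completion.coe_add, map_add, map_add, ha, hb]

theorem tensorMap_tmul (f : X →L[ℂ] X') (g : Y →L[ℂ] Y') (x : X) (y : Y) :
    tensorMap f g ((x ⊗ₜ[ℂ] y : X ⊗[ℂ] Y) : HilbertTensor X Y) = (f x ⊗ₜ[ℂ] g y : X' ⊗[ℂ] Y') := by
  rw [tensorMap_coe]; rfl

theorem tensorMap_add_left (f f' : X →L[ℂ] X') (g : Y →L[ℂ] Y') :
    tensorMap (f + f') g = tensorMap f g + tensorMap f' g :=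
  hilbertTensor_ext_tmul fun x y => by
    simp only [tensorMap_tmul, add_apply, add_tmul, UniformSpace.Completion.coe_add]

theorem tensorMap_add_right (f : X →L[ℂ] X') (g g' : Y →L[ℂ] Y') :
    tensorMap f (g + g') = tensorMap f g + tensorMap f g' :=
  hilbertTensor_ext_tmul fun x y => by
    simp only [tensorMap_tmul, add_apply, tmul_add, UniformSpace.Completion.coe_add]

theorem tensorMap_smul_left (c : ℂ) (f : X →L[ℂ] X') (g : Y →L[ℂ] Y') :
    tensorMap (c • f) g = c • tensorMap f g :=
  hilbertTensor_ext_tmul fun x y => by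
    simp only [tensorMap_tmul, smul_apply, ← smul_tmul', UniformSpace.Completion.coe_smul]

theorem tensorMap_smul_right (c : ℂ) (f : X →L[ℂ] X') (g : Y →L[ℂ] Y') :
    tensorMap f (c • g) = c • tensorMap f g :=
  hilbertTensor_ext_tmul fun x y => by
    simp only [tensorMap_tmul, smul_apply, tmul_smul, UniformSpace.Completion.coe_smul]

/-- `tensorMap` as a bilinear map. -/
def tensorMapₗ (X X' Y Y' : Type*) [NormedAddCommGroup X] [InnerProductSpace ℂ X]
    [NormedAddCommGroup X'] [InnerProductSpace ℂ X'] [NormedAddCommGroup Y] [InnerProductSpace ℂ Y]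
    [NormedAddCommGroup Y'] [InnerProductSpace ℂ Y'] :
    (X →L[ℂ] X') →ₗ[ℂ] (Y →L[ℂ] Y') →ₗ[ℂ] (HilbertTensor X Y →L[ℂ] HilbertTensor X' Y') :=
  LinearMap.mk₂ ℂ tensorMap tensorMap_add_left tensorMap_smul_left tensorMap_add_right
    tensorMap_smul_right

theorem tensorMapₗ_apply (f : X →L[ℂ] X') (g : Y →L[ℂ] Y') :
    tensorMapₗ X X' Y Y' f g = tensorMap f g := rfl

theorem tensorMap_comp (f' : X' →L[ℂ] X'') (f : X →L[ℂ] X') (g' : Y' →L[ℂ] Y'')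
    (g : Y →L[ℂ] Y') : tensorMap (f' ∘L f) (g' ∘L g) = tensorMap f' g' ∘L tensorMap f g :=
  hilbertTensor_ext_tmul fun x y => by
    simp only [tensorMap_tmul, ContinuousLinearMap.comp_apply]

theorem tensorMap_apply_apply (f' : X' →L[ℂ] X'') (f : X →L[ℂ] X') (g' : Y' →L[ℂ] Y'')
    (g : Y →L[ℂ] Y') (z : HilbertTensor X Y) :
    tensorMap f' g' (tensorMap f g z) = tensorMap (f' ∘L f) (g' ∘L g) z := by
  rw [tensorMap_comp]; rfl

theorem tensorMap_id : tensorMap (.id ℂ X) (.id ℂ Y) = .id ℂ (HilbertTensor X Y) :=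
  hilbertTensor_ext_tmul fun x y => by simp only [tensorMap_tmul, ContinuousLinearMap.id_apply]

theorem tensorOne_eq_tensorMap (a : X →L[ℂ] X) : tensorOne Y a = tensorMap a (.id ℂ Y) :=
  hilbertTensor_ext_tmul fun x y => by
    rw [tensorMap_tmul, tensorOne_coe]; rfl

theorem oneTensor_eq_tensorMap (b : Y →L[ℂ] Y) : oneTensor X b = tensorMap (.id ℂ X) b :=
  hilbertTensor_ext_tmul fun x y => by
    rw [tensorMap_tmul, oneTensor_coe, lTensor_apply]; rfl

theorem adjoint_tensorMap [CompleteSpace X] [CompleteSpace X'] [CompleteSpace Y] [CompleteSpace Y']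
    (f : X →L[ℂ] X') (g : Y →L[ℂ] Y') :
    adjoint (tensorMap f g) = tensorMap (adjoint f) (adjoint g) := by
  refine hilbertTensor_ext_tmul fun x y => ?_
  refine ext_inner_right ℂ fun v => ?_
  rw [adjoint_inner_left, tensorMap_tmul]
  induction v using UniformSpace.Completion.induction_on with
  | hp => exact isClosed_eq (by fun_prop) (by fun_prop)
  | ih t =>
    rw [tensorMap_coe, UniformSpace.Completion.inner_coe, UniformSpace.Completion.inner_coe]
    induction t with
    | zero => simp
    | tmul a b =>
      rw [TensorProduct.map_tmul, inner_tmul, inner_tmul]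
      simp only [ContinuousLinearMap.coe_coe, adjoint_inner_left]
    | add a b ha hb => rw [map_add, inner_add_right, inner_add_right, ha, hb]

end TensorMap

/-! ### The Künneth criterion for Hilbert differentials. -/

section Kunneth

variable {X Y : Type*} [NormedAddCommGroup X] [InnerProductSpace ℂ X]
  [NormedAddCommGroup Y] [InnerProductSpace ℂ Y]

/-- The differential of the tensor product of two Hilbert spaces with differentials `d` and `d'`,
where `ε` is the grading operator of the first one. -/
def tensorDiff (d ε : X →L[ℂ] X) (d' : Y →L[ℂ] Y) : HilbertTensor X Y →L[ℂ] HilbertTensor X Y :=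
  tensorMap d (.id ℂ Y) + tensorMap ε d'

/-- The homotopy is `h ⊗ 1`: its anticommutator with the differential is `(d h + h d) ⊗ 1 + (ε h + h
ε) ⊗ d'`, and the second term is why `h` must anticommute with `ε`. -/
theorem selfExact_tensorDiff_of_left (d ε h : X →L[ℂ] X) (d' : Y →L[ℂ] Y)
    (hh : d ∘L h + h ∘L d = .id ℂ X) (hε : ε ∘L h + h ∘L ε = 0) :
    SelfExact (tensorDiff d ε d') := by
  intro z hz
  refine ⟨tensorMap h (.id ℂ Y) z, ?_⟩
  have key : tensorDiff d ε d' ∘L tensorMap h (.id ℂ Y) +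
      tensorMap h (.id ℂ Y) ∘L tensorDiff d ε d' = .id ℂ _ := by
    rw [tensorDiff, ContinuousLinearMap.add_comp, ContinuousLinearMap.comp_add,
      ← tensorMap_comp, ← tensorMap_comp, ← tensorMap_comp, ← tensorMap_comp,
      add_add_add_comm, ContinuousLinearMap.id_comp, ContinuousLinearMap.comp_id,
      ← tensorMap_add_left, ContinuousLinearMap.id_comp, ← tensorMap_add_left, hh, hε, tensorMap_id,
      ← tensorMapₗ_apply, map_zero, LinearMap.zero_apply, add_zero]
  have := congrArg (fun T => T z) key
  simpa [hz] using this

/-- The homotopy is `ε ⊗ h`: its anticommutator with the differential is `(d ε + ε d) ⊗ h + ε² ⊗ (d'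
h + h d')`, so no condition relating `h` to a grading is needed. -/
theorem selfExact_tensorDiff_of_right (d ε : X →L[ℂ] X) (d' h : Y →L[ℂ] Y)
    (hεε : ε ∘L ε = .id ℂ X) (hεd : ε ∘L d = - (d ∘L ε))
    (hh : d' ∘L h + h ∘L d' = .id ℂ Y) :
    SelfExact (tensorDiff d ε d') := by
  intro z hz
  refine ⟨tensorMap ε h z, ?_⟩
  have key : tensorDiff d ε d' ∘L tensorMap ε h +
      tensorMap ε h ∘L tensorDiff d ε d' = .id ℂ _ := by
    rw [tensorDiff, ContinuousLinearMap.add_comp, ContinuousLinearMap.comp_add,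
      ← tensorMap_comp, ← tensorMap_comp, ← tensorMap_comp, ← tensorMap_comp,
      add_add_add_comm, ContinuousLinearMap.id_comp, ContinuousLinearMap.comp_id, hεε,
      ← tensorMap_add_right, ← tensorMap_add_left, hεd, hh, tensorMap_id, add_neg_cancel,
      ← tensorMapₗ_apply, map_zero, LinearMap.zero_apply, zero_add]
  have := congrArg (fun T => T z) key
  simpa [hz] using this

/-- Since `d` anticommutes with `ε`, the operator `-ε h ε` is a contracting homotopy whenever `h`
is. The mean of the two anticommutes with `ε`. -/
theorem exists_anticommuting_contraction [CompleteSpace X] (d ε : X →L[ℂ] X)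
    (hεε : ε ∘L ε = .id ℂ X) (hεd : ε ∘L d = - (d ∘L ε)) (hd : ∀ x, d (d x) = 0)
    (hex : SelfExact d) :
    ∃ h : X →L[ℂ] X, d ∘L h + h ∘L d = .id ℂ X ∧ ε ∘L h + h ∘L ε = 0 := by
  obtain ⟨h, hh⟩ := exists_contraction d hd hex
  have e1 : ∀ x, ε (ε x) = x := fun x => congrArg (fun T => T x) hεε
  have e2 : ∀ x, ε (d x) = - d (ε x) := fun x => congrArg (fun T => T x) hεd
  have e3 : ∀ x, d (ε x) = - ε (d x) := fun x => by rw [e2, neg_neg]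
  refine ⟨(1 / 2 : ℂ) • (h - ε ∘L h ∘L ε), ?_, ?_⟩
  · ext x
    have h1 := hh x
    have h2 : ε (d (h (ε x))) + ε (h (d (ε x))) = x := by rw [← map_add, hh, e1]
    simp only [add_apply, ContinuousLinearMap.comp_apply, smul_apply, sub_apply, map_smul, map_sub,
      ContinuousLinearMap.id_apply, e3 (h _)]
    rw [e3 x, map_neg, map_neg] at h2
    rw [← smul_add]
    have : d (h x) - -ε (d (h (ε x))) + (h (d x) - ε (h (ε (d x)))) = (2 : ℂ) • x := by
      calc _ = (d (h x) + h (d x)) + (ε (d (h (ε x))) + -ε (h (ε (d x)))) := by abel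
        _ = _ := by rw [h1, h2, two_smul]
    rw [this, smul_smul]
    norm_num
  · ext x
    simp only [add_apply, ContinuousLinearMap.comp_apply, smul_apply, sub_apply, map_smul, map_sub,
      e1, ← smul_add, zero_apply]
    simp

theorem exists_approx_null [CompleteSpace X] (d : X →L[ℂ] X) (hd : ∀ x, d (d x) = 0)
    (hex : ¬ SelfExact d) {c : ℝ} (hc : 0 < c) :
    ∃ x, ‖x‖ = 1 ∧ ‖d x‖ ≤ c ∧ ‖adjoint d x‖ ≤ c := by
  by_contra! hcon
  -- If every unit vector has `‖d x‖` or `‖d* x‖` above `c`, rescaling gives the estimate with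
  -- constant `c⁻¹`, which forces exactness.
  refine hex (selfExact_of_norm_le d hd c⁻¹ fun x => ?_)
  rcases eq_or_ne x 0 with rfl | hx
  · simp
  have hx' : 0 < ‖x‖ := norm_pos_iff.mpr hx
  have hn : ‖(((‖x‖ : ℝ) : ℂ)⁻¹) • x‖ = 1 := norm_smul_inv_norm hx
  rw [inv_mul_eq_div, le_div_iff₀ hc]
  have hs : ∀ T : X →L[ℂ] X, ‖T ((((‖x‖ : ℝ) : ℂ)⁻¹) • x)‖ = ‖T x‖ / ‖x‖ := fun T => by
    rw [map_smul, norm_smul, norm_inv, Complex.norm_real, norm_norm, inv_mul_eq_div]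
  by_cases h1 : ‖d x‖ / ‖x‖ ≤ c
  · have h2 := hcon _ hn (by rw [hs]; exact h1)
    rw [hs, lt_div_iff₀ hx'] at h2
    nlinarith [norm_nonneg (d x)]
  · rw [not_le, lt_div_iff₀ hx'] at h1
    nlinarith [norm_nonneg (adjoint d x)]

/-- **Künneth**: the tensor product of two Hilbert differentials is exact if and only if one of the
factors is. -/
theorem selfExact_tensorDiff_iff [CompleteSpace X] [CompleteSpace Y] (d ε : X →L[ℂ] X)
    (d' : Y →L[ℂ] Y) (hεε : ε ∘L ε = .id ℂ X) (hεd : ε ∘L d = - (d ∘L ε))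
    (hd : ∀ x, d (d x) = 0) (hd' : ∀ y, d' (d' y) = 0) :
    SelfExact (tensorDiff d ε d') ↔ SelfExact d ∨ SelfExact d' := by
  have hdd : tensorDiff d ε d' ∘L tensorDiff d ε d' = 0 := by
    have h1 : d ∘L d = 0 := by ext x; exact hd x
    have h2 : d' ∘L d' = 0 := by ext x; exact hd' x
    rw [tensorDiff, ContinuousLinearMap.add_comp, ContinuousLinearMap.comp_add,
      ContinuousLinearMap.comp_add, ← tensorMap_comp, ← tensorMap_comp, ← tensorMap_comp,
      ← tensorMap_comp, h1, h2, hεd, ContinuousLinearMap.id_comp, ContinuousLinearMap.id_comp,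
      ContinuousLinearMap.comp_id]
    simp only [← tensorMapₗ_apply, map_zero, LinearMap.zero_apply, map_neg, LinearMap.neg_apply]
    simp
  have hz : ∀ z, tensorDiff d ε d' (tensorDiff d ε d' z) = 0 := fun z =>
    congrArg (fun T => T z) hdd
  constructor
  · intro hex
    by_contra! hcon
    obtain ⟨h, hh⟩ := exists_contraction _ hz hex
    have hb := norm_le_of_contraction _ h hh
    -- With this `c` the estimate applied to the unit vector `u ⊗ v` reads `1 ≤ 1/2`. The summand 1
    -- in `‖h‖ + 1` avoids a division by zero.
    set c : ℝ := (2 * (‖h‖ + 1) * (2 + ‖ε‖ + ‖adjoint ε‖))⁻¹ with hc_def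
    have hc : 0 < c := by positivity
    obtain ⟨u, hu, hdu, hdu'⟩ := exists_approx_null d hd hcon.1 hc
    obtain ⟨v, hv, hdv, hdv'⟩ := exists_approx_null d' hd' hcon.2 hc
    have hadj : adjoint (tensorDiff d ε d') =
        tensorMap (adjoint d) (.id ℂ Y) + tensorMap (adjoint ε) (adjoint d') := by
      rw [tensorDiff, map_add, adjoint_tensorMap, adjoint_tensorMap]
      congr 2
      exact adjoint_id
    have hnorm : ∀ (x : X) (y : Y), ‖((x ⊗ₜ[ℂ] y : X ⊗[ℂ] Y) : HilbertTensor X Y)‖ = ‖x‖ * ‖y‖ :=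
      fun x y => by rw [UniformSpace.Completion.norm_coe, norm_tmul]
    have b1 : ‖tensorDiff d ε d' ((u ⊗ₜ[ℂ] v : X ⊗[ℂ] Y) : HilbertTensor X Y)‖ ≤
        c + ‖ε‖ * c := by
      rw [tensorDiff, add_apply, tensorMap_tmul, tensorMap_tmul]
      refine (norm_add_le _ _).trans (add_le_add ?_ ?_)
      · rw [hnorm, ContinuousLinearMap.id_apply, hv, mul_one]; exact hdu
      · rw [hnorm]
        refine mul_le_mul ?_ hdv (norm_nonneg _) (norm_nonneg _)
        simpa [hu] using ε.le_opNorm u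
    have b2 : ‖adjoint (tensorDiff d ε d') ((u ⊗ₜ[ℂ] v : X ⊗[ℂ] Y) : HilbertTensor X Y)‖ ≤
        c + ‖adjoint ε‖ * c := by
      rw [hadj, add_apply, tensorMap_tmul, tensorMap_tmul]
      refine (norm_add_le _ _).trans (add_le_add ?_ ?_)
      · rw [hnorm, ContinuousLinearMap.id_apply, hv, mul_one]; exact hdu'
      · rw [hnorm]
        refine mul_le_mul ?_ hdv' (norm_nonneg _) (norm_nonneg _)
        have := (adjoint ε).le_opNorm u
        rwa [hu, mul_one] at this
    have b3 := hb ((u ⊗ₜ[ℂ] v : X ⊗[ℂ] Y) : HilbertTensor X Y)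
    rw [hnorm, hu, hv, mul_one] at b3
    have b4 : (1 : ℝ) ≤ ‖h‖ * ((2 + ‖ε‖ + ‖adjoint ε‖) * c) :=
      b3.trans (mul_le_mul_of_nonneg_left (by linarith) (norm_nonneg _))
    have b5 : (‖h‖ + 1) * ((2 + ‖ε‖ + ‖adjoint ε‖) * c) = 1 / 2 := by
      rw [hc_def]
      have : (2 + ‖ε‖ + ‖adjoint ε‖) ≠ 0 := by positivity
      have : ‖h‖ + 1 ≠ 0 := by positivity
      field_simp
    have b6 : 0 ≤ (2 + ‖ε‖ + ‖adjoint ε‖) * c := by positivity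
    linarith
  · rintro (h | h)
    · obtain ⟨k, hk, hk'⟩ := exists_anticommuting_contraction d ε hεε hεd hd h
      exact selfExact_tensorDiff_of_left d ε k d' hk hk'
    · obtain ⟨k, hk⟩ := exists_contraction d' hd' h
      exact selfExact_tensorDiff_of_right d ε d' k hεε hεd (by ext x; exact hk x)

end Kunneth

end HilbertComplexes

/-! ### The total Koszul differential and Cartan calculus on `H ⊗ ⋀L`. -/

section Total

variable {L : Type*} [LieRing L] [LieAlgebra ℂ L] {I : Type*} [Fintype I]
  {H : Type*} [AddCommGroup H] [Module ℂ H]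

/-- Left exterior multiplication by `x`. -/
def wedge : L →ₗ[ℂ] ExteriorAlgebra ℂ L →ₗ[ℂ] ExteriorAlgebra ℂ L :=
  (LinearMap.mul ℂ (ExteriorAlgebra ℂ L)) ∘ₗ ExteriorAlgebra.ι ℂ

theorem wedge_apply (x : L) (w : ExteriorAlgebra ℂ L) : wedge x w = ExteriorAlgebra.ι ℂ x * w := rfl

theorem wedge_wedge (x y : L) (w : ExteriorAlgebra ℂ L) :
    wedge x (wedge y w) = - wedge y (wedge x w) := by
  simp only [wedge_apply, ← mul_assoc]
  rw [eq_neg_iff_add_eq_zero, ← add_mul, ExteriorAlgebra.ι_add_mul_swap, zero_mul]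

/-- Contraction with a linear form. -/
def contr : Module.Dual ℂ L →ₗ[ℂ] ExteriorAlgebra ℂ L →ₗ[ℂ] ExteriorAlgebra ℂ L :=
  CliffordAlgebra.contractLeft

theorem contr_one (φ : Module.Dual ℂ L) : contr φ (1 : ExteriorAlgebra ℂ L) = 0 :=
  CliffordAlgebra.contractLeft_one _ φ

theorem contr_wedge (φ : Module.Dual ℂ L) (x : L) (w : ExteriorAlgebra ℂ L) :
    contr φ (wedge x w) = φ x • w - wedge x (contr φ w) :=
  CliffordAlgebra.contractLeft_ι_mul φ x w

/-- The derivation of the exterior algebra that extends `ad x`. -/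
def adDer (b : Module.Basis I ℂ L) (x : L) : ExteriorAlgebra ℂ L →ₗ[ℂ] ExteriorAlgebra ℂ L :=
  ∑ j, wedge ⁅x, b j⁆ ∘ₗ contr (b.coord j)

theorem adDer_apply (b : Module.Basis I ℂ L) (x : L) (w : ExteriorAlgebra ℂ L) :
    adDer b x w = ∑ j, wedge ⁅x, b j⁆ (contr (b.coord j) w) := by
  simp [adDer]

/-- This removes the basis from calculations: operators defined by sums over a basis satisfy
basis-free identities. -/
theorem sum_coord_smul {M : Type*} [AddCommGroup M] [Module ℂ M] (b : Module.Basis I ℂ L)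
    (g : L →ₗ[ℂ] M) (y : L) : ∑ j, b.coord j y • g (b j) = g y := by
  conv_rhs => rw [← b.sum_repr y, map_sum]
  simp only [map_smul, Module.Basis.coord_apply]

theorem adDer_one (b : Module.Basis I ℂ L) (x : L) : adDer b x 1 = 0 := by
  simp [adDer_apply, contr_one]

theorem adDer_wedge (b : Module.Basis I ℂ L) (x y : L) (w : ExteriorAlgebra ℂ L) :
    adDer b x (wedge y w) = wedge ⁅x, y⁆ w + wedge y (adDer b x w) := by
  have h := sum_coord_smul b ((LinearMap.applyₗ w) ∘ₗ wedge ∘ₗ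
    (LieModule.toEnd ℂ L L x : L →ₗ[ℂ] L)) y
  simp only [LinearMap.comp_apply, LieModule.toEnd_apply_apply, LinearMap.applyₗ_apply_apply] at h
  simp only [adDer_apply, contr_wedge, map_sub, map_smul, Finset.sum_sub_distrib, h,
    wedge_wedge _ y, Finset.sum_neg_distrib, map_sum]
  abel

theorem adDer_eq_zero (b : Module.Basis I ℂ L) {x : L} (hx : ∀ y : L, ⁅x, y⁆ = 0) : adDer b x = 0 := by
  simp [adDer, hx]

/-- The Chevalley–Eilenberg differential on the exterior algebra. -/
def extDiff (b : Module.Basis I ℂ L) : ExteriorAlgebra ℂ L →ₗ[ℂ] ExteriorAlgebra ℂ L :=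
  (-(1 / 2 : ℂ)) • ∑ i, ∑ j, wedge ⁅b i, b j⁆ ∘ₗ contr (b.coord j) ∘ₗ contr (b.coord i)

theorem extDiff_apply (b : Module.Basis I ℂ L) (w : ExteriorAlgebra ℂ L) :
    extDiff b w = (-(1 / 2 : ℂ)) • ∑ i, adDer b (b i) (contr (b.coord i) w) := by
  simp [extDiff, adDer_apply]

theorem extDiff_one (b : Module.Basis I ℂ L) : extDiff b 1 = 0 := by
  simp [extDiff_apply, contr_one]

theorem adDer_add (b : Module.Basis I ℂ L) (x y : L) :
    adDer b (x + y) = adDer b x + adDer b y := by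
  refine LinearMap.ext fun w => ?_
  simp [adDer_apply, Finset.sum_add_distrib]

theorem adDer_smul (b : Module.Basis I ℂ L) (c : ℂ) (x : L) :
    adDer b (c • x) = c • adDer b x := by
  refine LinearMap.ext fun w => ?_
  simp [adDer_apply, Finset.smul_sum]

/-- The term `ad x` arises twice, once when the outer contraction hits `x` and once, by antisymmetry
of the bracket, when the inner one does. The factor 1/2 merges the two. -/
theorem extDiff_wedge (b : Module.Basis I ℂ L) (x : L) (w : ExteriorAlgebra ℂ L) :
    extDiff b (wedge x w) = - adDer b x w - wedge x (extDiff b w) := by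
  have h1 := sum_coord_smul b ((LinearMap.applyₗ w) ∘ₗ
    (⟨⟨adDer b, adDer_add b⟩, adDer_smul b⟩ :
      L →ₗ[ℂ] ExteriorAlgebra ℂ L →ₗ[ℂ] ExteriorAlgebra ℂ L)) x
  change ∑ j, b.coord j x • adDer b (b j) w = adDer b x w at h1
  have h2 : ∑ i, wedge ⁅b i, x⁆ (contr (b.coord i) w) = - adDer b x w := by
    rw [adDer_apply, ← Finset.sum_neg_distrib]
    refine Finset.sum_congr rfl fun i _ => ?_
    rw [← lie_skew, map_neg, LinearMap.neg_apply]
  simp only [extDiff_apply, contr_wedge, map_sub, map_smul, adDer_wedge, Finset.sum_sub_distrib,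
    Finset.sum_add_distrib, h1, h2, map_sum]
  have : ∀ u v : ExteriorAlgebra ℂ L, (-(1 / 2 : ℂ)) • (u - (-u + v)) = -u - (-(1 / 2 : ℂ)) • v := by
    intro u v
    module
  exact this _ _

/-- The sum of all Koszul differentials, for a family of operators `A x` on `H`. -/
def totalDiff (b : Module.Basis I ℂ L) (A : L →ₗ[ℂ] H →ₗ[ℂ] H) :
    H ⊗[ℂ] ExteriorAlgebra ℂ L →ₗ[ℂ] H ⊗[ℂ] ExteriorAlgebra ℂ L :=
  ∑ i, TensorProduct.map (A (b i)) (contr (b.coord i)) + (extDiff b).lTensor H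

theorem totalDiff_tmul (b : Module.Basis I ℂ L) (A : L →ₗ[ℂ] H →ₗ[ℂ] H) (e : H)
    (w : ExteriorAlgebra ℂ L) : totalDiff b A (e ⊗ₜ w) =
      ∑ i, A (b i) e ⊗ₜ contr (b.coord i) w + e ⊗ₜ extDiff b w := by
  simp [totalDiff]

theorem totalDiff_one (b : Module.Basis I ℂ L) (A : L →ₗ[ℂ] H →ₗ[ℂ] H) (e : H) :
    totalDiff b A (e ⊗ₜ 1) = 0 := by
  simp [totalDiff_tmul, contr_one, extDiff_one]

/-- Two additive properties checked on `e ⊗ 1` and stable under exterior multiplication hold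
everywhere. -/
theorem total_induction {P : H ⊗[ℂ] ExteriorAlgebra ℂ L → Prop}
    (hadd : ∀ s t, P s → P t → P (s + t)) (hone : ∀ e : H, P (e ⊗ₜ 1))
    (hwedge : ∀ (x : L) t, P t → P ((wedge x).lTensor H t)) (t : H ⊗[ℂ] ExteriorAlgebra ℂ L) :
    P t := by
  induction t with
  | zero => simpa using hone 0
  | add s t hs ht => exact hadd s t hs ht
  | tmul e w =>
    induction w using CliffordAlgebra.left_induction with
    | algebraMap r =>
      rw [Algebra.algebraMap_eq_smul_one, ← TensorProduct.smul_tmul]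
      exact hone _
    | add v w hv hw => rw [TensorProduct.tmul_add]; exact hadd _ _ hv hw
    | ι_mul w x hw => exact hwedge x _ hw

/-- The operators `A x - ad x` on `H ⊗ ⋀ L`. -/
def lieDer (b : Module.Basis I ℂ L) (A : L →ₗ[ℂ] H →ₗ[ℂ] H) (x : L) :
    H ⊗[ℂ] ExteriorAlgebra ℂ L →ₗ[ℂ] H ⊗[ℂ] ExteriorAlgebra ℂ L :=
  (A x).rTensor _ - (adDer b x).lTensor H

theorem lieDer_one (b : Module.Basis I ℂ L) (A : L →ₗ[ℂ] H →ₗ[ℂ] H) (x : L) (e : H) :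
    lieDer b A x (e ⊗ₜ 1) = A x e ⊗ₜ 1 := by
  simp [lieDer, adDer_one]

theorem lieDer_wedge (b : Module.Basis I ℂ L) (A : L →ₗ[ℂ] H →ₗ[ℂ] H) (x y : L)
    (t : H ⊗[ℂ] ExteriorAlgebra ℂ L) : lieDer b A x ((wedge y).lTensor H t) =
      (wedge y).lTensor H (lieDer b A x t) - (wedge ⁅x, y⁆).lTensor H t := by
  induction t with
  | zero => simp
  | add s t hs ht => simp only [map_add, hs, ht]; abel
  | tmul e w =>
    simp only [lieDer, LinearMap.sub_apply, LinearMap.lTensor_tmul, LinearMap.rTensor_tmul,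
      adDer_wedge, TensorProduct.tmul_add, map_sub]
    abel

/-- Cartan's formula. With the vanishing on `e ⊗ 1` it determines `totalDiff`, so later identities
reduce to `total_induction`. -/
theorem totalDiff_wedge (b : Module.Basis I ℂ L) (A : L →ₗ[ℂ] H →ₗ[ℂ] H) (x : L)
    (t : H ⊗[ℂ] ExteriorAlgebra ℂ L) : totalDiff b A ((wedge x).lTensor H t) =
      lieDer b A x t - (wedge x).lTensor H (totalDiff b A t) := by
  induction t with
  | zero => simp
  | add s t hs ht => simp only [map_add, hs, ht]; abel
  | tmul e w =>
    have h := sum_coord_smul b (((TensorProduct.mk ℂ H (ExteriorAlgebra ℂ L)).flip w) ∘ₗ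
      (LinearMap.applyₗ e) ∘ₗ A) x
    simp only [LinearMap.comp_apply, LinearMap.applyₗ_apply_apply, LinearMap.flip_apply,
      TensorProduct.mk_apply] at h
    simp only [lieDer, LinearMap.sub_apply, LinearMap.lTensor_tmul, LinearMap.rTensor_tmul,
      totalDiff_tmul, contr_wedge, extDiff_wedge, TensorProduct.tmul_sub, TensorProduct.tmul_smul,
      Finset.sum_sub_distrib, h, map_add, map_sum, TensorProduct.tmul_neg]
    abel

variable (b : Module.Basis I ℂ L) (A : L →ₗ[ℂ] H →ₗ[ℂ] H)

theorem lieDer_lieDer (hA : ∀ x y e, A ⁅x, y⁆ e = A y (A x e) - A x (A y e)) (x y : L)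
    (t : H ⊗[ℂ] ExteriorAlgebra ℂ L) :
    lieDer b A y (lieDer b A x t) - lieDer b A x (lieDer b A y t) = lieDer b A ⁅x, y⁆ t := by
  induction t using total_induction with
  | hadd s t hs ht => simp only [map_add, ← hs, ← ht]; abel
  | hone e => simp only [lieDer_one, hA, TensorProduct.sub_tmul]
  | hwedge z t ht =>
    simp only [lieDer_wedge, map_sub, ← ht, lie_lie x y z, LinearMap.lTensor_sub,
      LinearMap.sub_apply]
    abel

theorem totalDiff_lieDer (hA : ∀ x y e, A ⁅x, y⁆ e = A y (A x e) - A x (A y e)) (x : L)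
    (t : H ⊗[ℂ] ExteriorAlgebra ℂ L) :
    totalDiff b A (lieDer b A x t) = lieDer b A x (totalDiff b A t) := by
  induction t using total_induction with
  | hadd s t hs ht => simp only [map_add, hs, ht]
  | hone e => simp only [lieDer_one, totalDiff_one, map_zero]
  | hwedge y t ht =>
    simp only [lieDer_wedge, totalDiff_wedge, map_sub, ht, ← lieDer_lieDer b A hA x y]
    abel

/-- Cartan's formula and `totalDiff_lieDer` show that the square commutes with every `y ∧`; it also
kills `e ⊗ 1`. -/
theorem totalDiff_totalDiff (hA : ∀ x y e, A ⁅x, y⁆ e = A y (A x e) - A x (A y e))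
    (t : H ⊗[ℂ] ExteriorAlgebra ℂ L) : totalDiff b A (totalDiff b A t) = 0 := by
  induction t using total_induction with
  | hadd s t hs ht => simp only [map_add, hs, ht, add_zero]
  | hone e => simp only [totalDiff_one, map_zero]
  | hwedge y t ht =>
    simp only [totalDiff_wedge, map_sub, totalDiff_lieDer b A hA, ht, map_zero, sub_zero, sub_self]

theorem lieDer_of_central {z : L} (hz : ∀ y : L, ⁅z, y⁆ = 0) {c : ℂ} (hc : A z = c • LinearMap.id)
    (t : H ⊗[ℂ] ExteriorAlgebra ℂ L) : lieDer b A z t = c • t := by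
  simp [lieDer, adDer_eq_zero b hz, hc, LinearMap.rTensor_smul]

/-- By Cartan's formula the anticommutator of the differential with `z ∧` is multiplication by `c`,
so `c⁻¹ z ∧` is a contracting homotopy. -/
theorem selfExact_of_central {z : L} (hz : ∀ y : L, ⁅z, y⁆ = 0) {c : ℂ} (hc : A z = c • LinearMap.id)
    (h0 : c ≠ 0) : SelfExact (totalDiff b A) := by
  intro t ht
  refine ⟨c⁻¹ • (wedge z).lTensor H t, ?_⟩
  rw [map_smul, totalDiff_wedge, ht, map_zero, sub_zero, lieDer_of_central b A hz hc,
    smul_smul, inv_mul_cancel₀ h0, one_smul]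

section Functoriality

variable {L' : Type*} [LieRing L'] [LieAlgebra ℂ L'] {I' : Type*} [Fintype I']
  (b' : Module.Basis I' ℂ L') (A' : L' →ₗ[ℂ] H →ₗ[ℂ] H) (φ : L →ₗ⁅ℂ⁆ L')

variable (H) in
/-- The map between Koszul complexes induced by a Lie homomorphism. -/
def totalMap : H ⊗[ℂ] ExteriorAlgebra ℂ L →ₗ[ℂ] H ⊗[ℂ] ExteriorAlgebra ℂ L' :=
  (ExteriorAlgebra.map (φ : L →ₗ[ℂ] L')).toLinearMap.lTensor H

theorem totalMap_one (e : H) : totalMap H φ (e ⊗ₜ 1) = e ⊗ₜ 1 := by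
  simp [totalMap]

theorem totalMap_wedge (x : L) (t : H ⊗[ℂ] ExteriorAlgebra ℂ L) :
    totalMap H φ ((wedge x).lTensor H t) = (wedge (φ x)).lTensor H (totalMap H φ t) := by
  induction t with
  | zero => simp
  | add s t hs ht => simp only [map_add, hs, ht]
  | tmul e w => simp [totalMap, wedge_apply]

variable {A A'} (hφ : ∀ x, A x = A' (φ x))
include hφ

theorem totalMap_lieDer (x : L) (t : H ⊗[ℂ] ExteriorAlgebra ℂ L) :
    totalMap H φ (lieDer b A x t) = lieDer b' A' (φ x) (totalMap H φ t) := by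
  induction t using total_induction with
  | hadd s t hs ht => simp only [map_add, hs, ht]
  | hone e => simp only [lieDer_one, totalMap_one, hφ]
  | hwedge y t ht => simp only [lieDer_wedge, map_sub, totalMap_wedge, ht, LieHom.map_lie]

/-- The induced map intertwines exterior multiplications and Lie derivatives, hence by Cartan's
formula the differentials, for any choice of bases. -/
theorem totalMap_totalDiff (t : H ⊗[ℂ] ExteriorAlgebra ℂ L) :
    totalMap H φ (totalDiff b A t) = totalDiff b' A' (totalMap H φ t) := by
  induction t using total_induction with
  | hadd s t hs ht => simp only [map_add, hs, ht]
  | hone e => simp only [totalDiff_one, totalMap_one, map_zero]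
  | hwedge y t ht =>
    simp only [totalDiff_wedge, map_sub, totalMap_wedge, ht, totalMap_lieDer b b' φ hφ]

end Functoriality

end Total

/-! ### Comparison of the total differential with the graded Koszul complex. -/

section Graded

theorem contr_ιMulti {L : Type*} [LieRing L] [LieAlgebra ℂ L] (φ : Module.Dual ℂ L) (p : ℕ)
    (v : Fin (p + 1) → L) : contr φ (ExteriorAlgebra.ιMulti ℂ (p + 1) v) =
      ∑ k : Fin (p + 1), (-1 : ℤ) ^ (k : ℕ) •
        (φ (v k) • ExteriorAlgebra.ιMulti ℂ p (k.removeNth v)) := by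
  induction p with
  | zero =>
    rw [ExteriorAlgebra.ιMulti_succ_apply, ← wedge_apply, contr_wedge]
    simp [contr_one]
  | succ p ih =>
    rw [ExteriorAlgebra.ιMulti_succ_apply, ← wedge_apply, contr_wedge, ih, sub_eq_add_neg,
      map_sum, ← Finset.sum_neg_distrib, Fin.sum_univ_succ (n := p + 1)]
    congr 1
    · simp [Matrix.vecTail, Function.comp_def, Fin.tail]
    · refine Finset.sum_congr rfl fun k _ => ?_
      rw [ExteriorAlgebra.ιMulti_succ_apply (k.succ.removeNth v), ← wedge_apply, map_zsmul,
        map_smul, Fin.val_succ, pow_succ, mul_neg_one, neg_smul]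
      have h0 : k.succ.removeNth v 0 = v 0 := by simp [Fin.removeNth]
      have h1 : Matrix.vecTail (k.succ.removeNth v) = k.removeNth (Matrix.vecTail v) := by
        ext i
        simp [Matrix.vecTail, Fin.removeNth]
      rw [h0, h1]
      rfl

variable {L : Type*} [LieRing L] [LieAlgebra ℂ L] {I : Type*} [Fintype I]
  (b : Module.Basis I ℂ L)

theorem adDer_ιMulti (x : L) (q : ℕ) (w : Fin (q + 1) → L) :
    adDer b x (ExteriorAlgebra.ιMulti ℂ (q + 1) w) =
      ∑ l : Fin (q + 1), (-1 : ℤ) ^ (l : ℕ) • ExteriorAlgebra.ιMulti ℂ (q + 1)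
        (Matrix.vecCons ⁅x, w l⁆ (l.removeNth w)) := by
  simp only [adDer_apply, contr_ιMulti, map_sum, map_zsmul, map_smul]
  rw [Finset.sum_comm]
  refine Finset.sum_congr rfl fun l _ => ?_
  rw [← Finset.smul_sum]
  congr 1
  have h := sum_coord_smul b ((LinearMap.applyₗ (ExteriorAlgebra.ιMulti ℂ q (l.removeNth w))) ∘ₗ
    wedge ∘ₗ (LieModule.toEnd ℂ L L x : L →ₗ[ℂ] L)) (w l)
  refine h.trans ?_
  rw [ExteriorAlgebra.ιMulti_succ_apply]
  rfl

theorem extDiff_ιMulti_one (v : Fin 1 → L) :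
    extDiff b (ExteriorAlgebra.ιMulti ℂ 1 v) = 0 := by
  rw [ExteriorAlgebra.ιMulti_succ_apply, ← wedge_apply, extDiff_wedge,
    ExteriorAlgebra.ιMulti_zero_apply, adDer_one, extDiff_one]
  simp

theorem extDiff_ιMulti (q : ℕ) (v : Fin (q + 2) → L) :
    extDiff b (ExteriorAlgebra.ιMulti ℂ (q + 2) v) = (-(1 / 2 : ℂ)) •
      ∑ k : Fin (q + 2), (-1 : ℤ) ^ (k : ℕ) • ∑ l : Fin (q + 1), (-1 : ℤ) ^ (l : ℕ) •
        ExteriorAlgebra.ιMulti ℂ (q + 1)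
          (Matrix.vecCons ⁅v k, k.removeNth v l⁆ (l.removeNth (k.removeNth v))) := by
  simp only [extDiff_apply, contr_ιMulti, map_sum, map_zsmul, map_smul]
  rw [Finset.sum_comm]
  congr 1
  refine Finset.sum_congr rfl fun k _ => ?_
  rw [← Finset.smul_sum, ← adDer_ιMulti b]
  congr 1
  exact sum_coord_smul b ((LinearMap.applyₗ (ExteriorAlgebra.ιMulti ℂ (q + 1) (k.removeNth v))) ∘ₗ
    (⟨⟨adDer b, adDer_add b⟩, adDer_smul b⟩ :
      L →ₗ[ℂ] ExteriorAlgebra ℂ L →ₗ[ℂ] ExteriorAlgebra ℂ L)) (v k)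

variable {H : Type*} [NormedAddCommGroup H] [InnerProductSpace ℂ H]

/-- The inclusion of the degree `p` part. -/
def totalIncl (H L : Type*) [NormedAddCommGroup H] [InnerProductSpace ℂ H] [LieRing L]
    [LieAlgebra ℂ L] (p : ℕ) : H ⊗[ℂ] ⋀[ℂ]^p L →ₗ[ℂ] H ⊗[ℂ] ExteriorAlgebra ℂ L :=
  (⋀[ℂ]^p L).subtype.lTensor H

/-- On `e ⊗ (x₁ ∧ … ∧ xₚ₊₁)`, the single contractions reproduce `actionTerm`. The double
contractions in `extDiff`, which count each pair in both orders, match `bracketTerm` summand by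
summand, including the factor `-1/2`. -/
theorem totalDiff_totalIncl (ρ : L →ₗ⁅ℂ⁆ (H →L[ℂ] H)ᵐᵒᵖ) (f : Module.Dual ℂ L) (p : ℕ)
    (z : H ⊗[ℂ] ⋀[ℂ]^(p + 1) L) :
    totalDiff b (shift ρ f) (totalIncl H L (p + 1) z) = totalIncl H L p (koszulD ρ f p z) := by
  have h : totalDiff b (shift ρ f) ∘ₗ totalIncl H L (p + 1) =
      totalIncl H L p ∘ₗ koszulD ρ f p := by
    refine TensorProduct.ext (LinearMap.ext fun e => ?_)
    refine exteriorPower.linearMap_ext (AlternatingMap.ext fun v => ?_)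
    change totalDiff b (shift ρ f) (e ⊗ₜ ExteriorAlgebra.ιMulti ℂ (p + 1) v) =
      totalIncl H L p (koszulD ρ f p (e ⊗ₜ exteriorPower.ιMulti ℂ (p + 1) v))
    have h1 : koszulD ρ f p (e ⊗ₜ exteriorPower.ιMulti ℂ (p + 1) v) =
        actionTerm ρ f p v e + bracketTerm H L p v e := by
      simp [koszulD, exteriorPower.alternatingMapLinearEquiv_apply_ιMulti]
    rw [h1, map_add, totalDiff_tmul]
    congr 1
    · simp only [actionTerm, AlternatingMap.alternatizeUncurryFin_apply, LinearMap.sum_apply,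
        contr_ιMulti, TensorProduct.tmul_sum, map_sum]
      rw [Finset.sum_comm]
      refine Finset.sum_congr rfl fun k _ => ?_
      have h2 := sum_coord_smul b (((TensorProduct.mk ℂ H (ExteriorAlgebra ℂ L)).flip
        (ExteriorAlgebra.ιMulti ℂ p (k.removeNth v))) ∘ₗ
          (LinearMap.applyₗ e) ∘ₗ shift ρ f) (v k)
      rw [LinearMap.smul_apply, map_zsmul]
      refine Eq.trans ?_ (congrArg (fun t => (-1 : ℤ) ^ (k : ℕ) • t) h2)
      rw [Finset.smul_sum]
      refine Finset.sum_congr rfl fun i _ => ?_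
      rw [TensorProduct.tmul_smul, TensorProduct.tmul_smul]
      rfl
    · cases p with
      | zero => rw [extDiff_ιMulti_one]; simp [bracketTerm]
      | succ q =>
        rw [extDiff_ιMulti]
        simp only [bracketTerm, AlternatingMap.smul_apply, LinearMap.smul_apply,
          AlternatingMap.alternatizeUncurryFin_apply, LinearMap.sum_apply, map_sum, map_smul,
          TensorProduct.tmul_smul, TensorProduct.tmul_sum, map_zsmul, LinearMap.comp_apply,
          AlternatingMap.alternatizeUncurryFinLM_apply]
        rfl
  exact congrArg (fun T => T z) h

theorem totalDiff_totalIncl_zero (A : L →ₗ[ℂ] H →ₗ[ℂ] H) (z : H ⊗[ℂ] ⋀[ℂ]^0 L) :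
    totalDiff b A (totalIncl H L 0 z) = 0 := by
  have h : totalDiff b A ∘ₗ totalIncl H L 0 = 0 := by
    refine TensorProduct.ext (LinearMap.ext fun e => ?_)
    refine exteriorPower.linearMap_ext (AlternatingMap.ext fun v => ?_)
    change totalDiff b A (e ⊗ₜ ExteriorAlgebra.ιMulti ℂ 0 v) = 0
    rw [ExteriorAlgebra.ιMulti_zero_apply, totalDiff_one]
  exact congrArg (fun T => T z) h

/-- The projection to the degree `p` part. -/
def totalProj (H L : Type*) [NormedAddCommGroup H] [InnerProductSpace ℂ H] [LieRing L]
    [LieAlgebra ℂ L] (p : ℕ) : H ⊗[ℂ] ExteriorAlgebra ℂ L →ₗ[ℂ] H ⊗[ℂ] ⋀[ℂ]^p L :=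
  (DirectSum.component ℂ ℕ (fun n => ⋀[ℂ]^n L) p ∘ₗ
    (DirectSum.decomposeLinearEquiv (fun n => ⋀[ℂ]^n L)).toLinearMap).lTensor H

theorem totalProj_totalIncl_self (p : ℕ) (z : H ⊗[ℂ] ⋀[ℂ]^p L) :
    totalProj H L p (totalIncl H L p z) = z := by
  induction z with
  | zero => simp
  | add s t hs ht => simp only [map_add, hs, ht]
  | tmul e w =>
    simp [totalProj, totalIncl, DirectSum.component.lof_self]

theorem totalProj_totalIncl_of_ne {p q : ℕ} (hpq : p ≠ q) (z : H ⊗[ℂ] ⋀[ℂ]^p L) :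
    totalProj H L q (totalIncl H L p z) = 0 := by
  induction z with
  | zero => simp
  | add s t hs ht => simp only [map_add, hs, ht, add_zero]
  | tmul e w =>
    simp [totalProj, totalIncl, DirectSum.component.of, hpq]

/-- Asking for all `M ≥ N` rather than for one bound lets two elements share a range and lets the
range be enlarged at will. -/
theorem exists_sum_totalIncl (t : H ⊗[ℂ] ExteriorAlgebra ℂ L) :
    ∃ N, ∀ M, N ≤ M → ∑ p ∈ Finset.range M, totalIncl H L p (totalProj H L p t) = t := by
  induction t with
  | zero => exact ⟨0, fun M _ => by simp⟩
  | add s t hs ht =>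
    obtain ⟨N, hN⟩ := hs
    obtain ⟨N', hN'⟩ := ht
    refine ⟨max N N', fun M hM => ?_⟩
    simp only [map_add, Finset.sum_add_distrib]
    rw [hN M (le_of_max_le_left hM), hN' M (le_of_max_le_right hM)]
  | tmul e w =>
    classical
    refine ⟨(DirectSum.decompose (fun n => ⋀[ℂ]^n L) w).support.sup id + 1, fun M hM => ?_⟩
    have h1 : ∀ p, totalIncl H L p (totalProj H L p (e ⊗ₜ w)) =
        e ⊗ₜ (DirectSum.decompose (fun n => ⋀[ℂ]^n L) w p : ExteriorAlgebra ℂ L) := fun p => rfl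
    simp only [h1, ← TensorProduct.tmul_sum]
    congr 1
    conv_rhs => rw [← DirectSum.sum_support_decompose (fun n => ⋀[ℂ]^n L) w]
    symm
    refine Finset.sum_subset (fun p hp => ?_) (fun p _ hp => ?_)
    · have := Finset.le_sup (f := id) hp
      simp only [id] at this
      exact Finset.mem_range.mpr (by omega)
    · simpa using hp

theorem totalProj_totalDiff (ρ : L →ₗ⁅ℂ⁆ (H →L[ℂ] H)ᵐᵒᵖ) (f : Module.Dual ℂ L) (p : ℕ)
    (t : H ⊗[ℂ] ExteriorAlgebra ℂ L) :
    totalProj H L p (totalDiff b (shift ρ f) t) = koszulD ρ f p (totalProj H L (p + 1) t) := by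
  obtain ⟨N, hN⟩ := exists_sum_totalIncl t
  -- The bound `p + 2` ensures that degree `p + 1`, the only one contributing, lies in the range.
  conv_lhs => rw [← hN (max N (p + 2)) (le_max_left _ _)]
  rw [map_sum, map_sum, Finset.sum_eq_single (p + 1)]
  · rw [totalDiff_totalIncl, totalProj_totalIncl_self]
  · intro q _ hq
    cases q with
    | zero => rw [totalDiff_totalIncl_zero, map_zero]
    | succ q =>
      rw [totalDiff_totalIncl, totalProj_totalIncl_of_ne (by omega)]
  · intro h
    exact absurd (Finset.mem_range.mpr (by omega)) h

/-- The differential is homogeneous of degree `-1`, so cycles and preimages can be taken degree by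
degree; only finitely many degrees occur in a given element. -/
theorem selfExact_totalDiff_iff (ρ : L →ₗ⁅ℂ⁆ (H →L[ℂ] H)ᵐᵒᵖ) (f : Module.Dual ℂ L) :
    SelfExact (totalDiff b (shift ρ f)) ↔
      ∀ p, koszulCycles ρ f p ≤ LinearMap.range (koszulD ρ f p) := by
  constructor
  · intro h p z hz
    have h0 : totalDiff b (shift ρ f) (totalIncl H L p z) = 0 := by
      cases p with
      | zero => exact totalDiff_totalIncl_zero b _ z
      | succ p => rw [totalDiff_totalIncl, show koszulD ρ f p z = 0 from hz, map_zero]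
    obtain ⟨y, hy⟩ := h _ h0
    refine ⟨totalProj H L (p + 1) y, ?_⟩
    rw [← totalProj_totalDiff b, hy, totalProj_totalIncl_self]
  · intro h t ht
    have hcyc : ∀ p, totalProj H L p t ∈ koszulCycles ρ f p := fun p => by
      cases p with
      | zero => exact Submodule.mem_top
      | succ p =>
        change koszulD ρ f p (totalProj H L (p + 1) t) = 0
        rw [← totalProj_totalDiff b, ht, map_zero]
    choose y hy using fun p => h p (hcyc p)
    obtain ⟨N, hN⟩ := exists_sum_totalIncl t
    refine ⟨∑ p ∈ Finset.range N, totalIncl H L (p + 1) (y p), ?_⟩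
    rw [map_sum]
    conv_rhs => rw [← hN N le_rfl]
    refine Finset.sum_congr rfl fun p _ => ?_
    rw [totalDiff_totalIncl, hy]

theorem mem_jointSpectrum_iff (ρ : L →ₗ⁅ℂ⁆ (H →L[ℂ] H)ᵐᵒᵖ) (f : Module.Dual ℂ L) :
    f ∈ jointSpectrum ρ ↔
      (∀ x y : L, f ⁅x, y⁆ = 0) ∧ ¬ SelfExact (totalDiff b (shift ρ f)) := by
  rw [selfExact_totalDiff_iff, not_forall]
  refine and_congr_right fun _ => exists_congr fun p => ?_
  rw [Submodule.Quotient.nontrivial_iff, ne_eq, Submodule.submoduleOf_eq_top]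

/-- The scalar parts commute and `f` kills brackets, so subtracting a character keeps a right
action; the opposite product accounts for the order of the factors. This makes the square of the
differential zero. -/
theorem shift_lie (ρ : L →ₗ⁅ℂ⁆ (H →L[ℂ] H)ᵐᵒᵖ) {f : Module.Dual ℂ L}
    (hf : ∀ x y : L, f ⁅x, y⁆ = 0) (x y : L) (e : H) :
    shift ρ f ⁅x, y⁆ e = shift ρ f y (shift ρ f x e) - shift ρ f x (shift ρ f y e) := by
  simp only [shift, LinearMap.coe_mk, AddHom.coe_mk, LieHom.map_lie, hf, zero_smul, sub_zero,
    LieRing.of_associative_ring_bracket, MulOpposite.unop_sub, MulOpposite.unop_mul,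
    LinearMap.sub_apply, ContinuousLinearMap.coe_coe, LinearMap.smul_apply, LinearMap.id_apply,
    map_sub, map_smul, sub_apply, mul_apply_eq_comp, smul_sub]
  rw [smul_comm (f x) (f y) e]
  abel

end Graded

/-! ### The exterior algebra of a product as a graded tensor product. -/

section ExteriorProd

variable {L₁ L₂ : Type*} [LieRing L₁] [LieAlgebra ℂ L₁] [LieRing L₂] [LieAlgebra ℂ L₂]

/-- The parity operator of the exterior algebra. -/
def parity (L : Type*) [LieRing L] [LieAlgebra ℂ L] :
    ExteriorAlgebra ℂ L →ₗ[ℂ] ExteriorAlgebra ℂ L :=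
  CliffordAlgebra.involute.toLinearMap

theorem parity_one {L : Type*} [LieRing L] [LieAlgebra ℂ L] :
    parity L 1 = 1 := map_one CliffordAlgebra.involute

theorem parity_parity {L : Type*} [LieRing L] [LieAlgebra ℂ L] (w : ExteriorAlgebra ℂ L) :
    parity L (parity L w) = w := CliffordAlgebra.involute_involute w

theorem parity_wedge {L : Type*} [LieRing L] [LieAlgebra ℂ L] (x : L) (w : ExteriorAlgebra ℂ L) :
    parity L (wedge x w) = - wedge x (parity L w) := by
  refine (map_mul CliffordAlgebra.involute _ _).trans ?_
  rw [wedge_apply, ← neg_mul]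
  congr 1
  exact CliffordAlgebra.involute_ι x

theorem exterior_induction {L : Type*} [LieRing L] [LieAlgebra ℂ L]
    {P : ExteriorAlgebra ℂ L → Prop} (hadd : ∀ s t, P s → P t → P (s + t))
    (hone : ∀ c : ℂ, P (c • 1)) (hwedge : ∀ (x : L) t, P t → P (wedge x t))
    (t : ExteriorAlgebra ℂ L) : P t := by
  induction t using CliffordAlgebra.left_induction with
  | algebraMap r => rw [Algebra.algebraMap_eq_smul_one]; exact hone r
  | add v w hv hw => exact hadd _ _ hv hw
  | ι_mul w x hw => exact hwedge x _ hw

theorem contr_parity {L : Type*} [LieRing L] [LieAlgebra ℂ L] (φ : Module.Dual ℂ L)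
    (w : ExteriorAlgebra ℂ L) : contr φ (parity L w) = - parity L (contr φ w) := by
  induction w using exterior_induction with
  | hadd s t hs ht => simp only [map_add, hs, ht, neg_add]
  | hone c => simp [parity_one, contr_one]
  | hwedge x t ht =>
    simp only [parity_wedge, contr_wedge, map_neg, map_sub, map_smul, ht]

theorem adDer_parity {L : Type*} [LieRing L] [LieAlgebra ℂ L] {I : Type*} [Fintype I]
    (b : Module.Basis I ℂ L) (x : L) (w : ExteriorAlgebra ℂ L) :
    adDer b x (parity L w) = parity L (adDer b x w) := by
  simp only [adDer_apply, contr_parity, map_neg, map_sum, parity_wedge]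

theorem extDiff_parity {L : Type*} [LieRing L] [LieAlgebra ℂ L] {I : Type*} [Fintype I]
    (b : Module.Basis I ℂ L) (w : ExteriorAlgebra ℂ L) :
    extDiff b (parity L w) = - parity L (extDiff b w) := by
  simp only [extDiff_apply, contr_parity, map_neg, map_sum, adDer_parity, map_smul,
    Finset.sum_neg_distrib, smul_neg]

/-- The multiplication map `⋀ L₁ ⊗ ⋀ L₂ → ⋀ (L₁ × L₂)`. -/
def extProd (L₁ L₂ : Type*) [LieRing L₁] [LieAlgebra ℂ L₁] [LieRing L₂] [LieAlgebra ℂ L₂] :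
    ExteriorAlgebra ℂ L₁ ⊗[ℂ] ExteriorAlgebra ℂ L₂ →ₗ[ℂ] ExteriorAlgebra ℂ (L₁ × L₂) :=
  LinearMap.mul' ℂ _ ∘ₗ TensorProduct.map
    (ExteriorAlgebra.map (LinearMap.inl ℂ L₁ L₂)).toLinearMap
    (ExteriorAlgebra.map (LinearMap.inr ℂ L₁ L₂)).toLinearMap

theorem extProd_tmul (v : ExteriorAlgebra ℂ L₁) (w : ExteriorAlgebra ℂ L₂) :
    extProd L₁ L₂ (v ⊗ₜ w) = ExteriorAlgebra.map (LinearMap.inl ℂ L₁ L₂) v *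
      ExteriorAlgebra.map (LinearMap.inr ℂ L₁ L₂) w := rfl

theorem wedge_inl_extProd (x : L₁) (v : ExteriorAlgebra ℂ L₁) (w : ExteriorAlgebra ℂ L₂) :
    wedge (x, (0 : L₂)) (extProd L₁ L₂ (v ⊗ₜ w)) = extProd L₁ L₂ (wedge x v ⊗ₜ w) := by
  simp only [extProd_tmul, wedge_apply, map_mul, ExteriorAlgebra.map_apply_ι, mul_assoc]
  rfl

theorem extProd_one_tmul (w : ExteriorAlgebra ℂ L₂) : extProd L₁ L₂ (1 ⊗ₜ w) =
    ExteriorAlgebra.map (LinearMap.inr ℂ L₁ L₂) w := by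
  rw [extProd_tmul, map_one, one_mul]

/-- Moving `y` past `v` costs one sign per degree of `v`; this is the source of the parity operator
in the tensor differential. -/
theorem wedge_inr_extProd (y : L₂) (v : ExteriorAlgebra ℂ L₁) (w : ExteriorAlgebra ℂ L₂) :
    wedge ((0 : L₁), y) (extProd L₁ L₂ (v ⊗ₜ w)) =
      extProd L₁ L₂ (parity L₁ v ⊗ₜ wedge y w) := by
  induction v using exterior_induction with
  | hadd s t hs ht => simp only [TensorProduct.add_tmul, map_add, hs, ht]
  | hone c =>
    simp only [← TensorProduct.smul_tmul', map_smul, parity_one, extProd_one_tmul, wedge_apply,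
      map_mul, ExteriorAlgebra.map_apply_ι]
    rfl
  | hwedge x t ht =>
    rw [← wedge_inl_extProd, wedge_wedge, ht, wedge_inl_extProd, parity_wedge,
      TensorProduct.neg_tmul, map_neg]

theorem contr_map {L L' : Type*} [LieRing L] [LieAlgebra ℂ L] [LieRing L'] [LieAlgebra ℂ L']
    (φ : Module.Dual ℂ L') (g : L →ₗ[ℂ] L') (w : ExteriorAlgebra ℂ L) :
    contr φ (ExteriorAlgebra.map g w) = ExteriorAlgebra.map g (contr (φ ∘ₗ g) w) := by
  induction w using exterior_induction with
  | hadd s t hs ht => simp only [map_add, hs, ht]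
  | hone c => simp [contr_one]
  | hwedge x t ht =>
    have h : ∀ (x : L) t, ExteriorAlgebra.map g (wedge x t) =
        wedge (g x) (ExteriorAlgebra.map g t) := fun x t => by simp [wedge_apply]
    rw [h, contr_wedge, contr_wedge, map_sub, map_smul, h, ht]
    rfl

theorem contr_extProd (φ : Module.Dual ℂ (L₁ × L₂)) (v : ExteriorAlgebra ℂ L₁)
    (w : ExteriorAlgebra ℂ L₂) : contr φ (extProd L₁ L₂ (v ⊗ₜ w)) =
      extProd L₁ L₂ (contr (φ ∘ₗ LinearMap.inl ℂ L₁ L₂) v ⊗ₜ w) +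
        extProd L₁ L₂ (parity L₁ v ⊗ₜ contr (φ ∘ₗ LinearMap.inr ℂ L₁ L₂) w) := by
  induction v using exterior_induction with
  | hadd s t hs ht => simp only [TensorProduct.add_tmul, map_add, hs, ht]; abel
  | hone c =>
    simp only [← TensorProduct.smul_tmul', map_smul, parity_one, extProd_one_tmul, contr_map,
      contr_one, smul_zero, TensorProduct.zero_tmul, map_zero, zero_add]
  | hwedge x t ht =>
    rw [← wedge_inl_extProd, contr_wedge, ht, contr_wedge, map_add, wedge_inl_extProd,
      wedge_inl_extProd, parity_wedge, TensorProduct.sub_tmul, TensorProduct.neg_tmul, map_neg,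
      map_sub, ← TensorProduct.smul_tmul', map_smul]
    change φ (x, 0) • _ - _ = φ (x, 0) • _ - _ + _
    abel

theorem extProd_surjective : Function.Surjective (extProd L₁ L₂) := by
  intro z
  induction z using exterior_induction with
  | hadd s t hs ht =>
    obtain ⟨s', rfl⟩ := hs
    obtain ⟨t', rfl⟩ := ht
    exact ⟨s' + t', map_add _ _ _⟩
  | hone c => exact ⟨c • (1 ⊗ₜ 1), by rw [map_smul, extProd_one_tmul, map_one]⟩
  | hwedge x t ht =>
    obtain ⟨t', rfl⟩ := ht
    induction t' with
    | zero => exact ⟨0, by simp⟩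
    | add s t hs ht =>
      obtain ⟨s', hs⟩ := hs
      obtain ⟨t', ht⟩ := ht
      exact ⟨s' + t', by rw [map_add, map_add, map_add, hs, ht]⟩
    | tmul v w =>
      refine ⟨wedge x.1 v ⊗ₜ w + parity L₁ v ⊗ₜ wedge x.2 w, ?_⟩
      rw [map_add, ← wedge_inl_extProd, ← wedge_inr_extProd, ← LinearMap.add_apply, ← map_add]
      simp

theorem finrank_exteriorAlgebra (L : Type*) [LieRing L] [LieAlgebra ℂ L]
    [FiniteDimensional ℂ L] :
    Module.finrank ℂ (ExteriorAlgebra ℂ L) = 2 ^ Module.finrank ℂ L := by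
  rw [Module.finrank_eq_card_basis (Module.finBasis ℂ L).ExteriorAlgebra, Fintype.card_finset,
    Fintype.card_fin]

theorem finite_exteriorAlgebra (L : Type*) [LieRing L] [LieAlgebra ℂ L]
    [FiniteDimensional ℂ L] : FiniteDimensional ℂ (ExteriorAlgebra ℂ L) :=
  (Module.finBasis ℂ L).ExteriorAlgebra.finiteDimensional_of_finite

/-- The range contains 1 and is stable under exterior multiplication, and both sides have dimension
`2 ^ (dim L₁ + dim L₂)`. -/
theorem extProd_bijective [FiniteDimensional ℂ L₁] [FiniteDimensional ℂ L₂] :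
    Function.Bijective (extProd L₁ L₂) := by
  have := finite_exteriorAlgebra L₁
  have := finite_exteriorAlgebra L₂
  have := finite_exteriorAlgebra (L₁ × L₂)
  refine ⟨(LinearMap.injective_iff_surjective_of_finrank_eq_finrank ?_).mpr extProd_surjective,
    extProd_surjective⟩
  rw [Module.finrank_tensorProduct, finrank_exteriorAlgebra, finrank_exteriorAlgebra,
    finrank_exteriorAlgebra, Module.finrank_prod, pow_add]

variable {I₁ I₂ : Type*} (b₁ : Module.Basis I₁ ℂ L₁)
  (b₂ : Module.Basis I₂ ℂ L₂)

theorem contr_inl_extProd (i : I₁) (v : ExteriorAlgebra ℂ L₁) (w : ExteriorAlgebra ℂ L₂) :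
    contr ((b₁.prod b₂).coord (Sum.inl i)) (extProd L₁ L₂ (v ⊗ₜ w)) =
      extProd L₁ L₂ (contr (b₁.coord i) v ⊗ₜ w) := by
  have h1 : (b₁.prod b₂).coord (Sum.inl i) ∘ₗ LinearMap.inl ℂ L₁ L₂ = b₁.coord i := by
    ext x; simp
  have h2 : (b₁.prod b₂).coord (Sum.inl i) ∘ₗ LinearMap.inr ℂ L₁ L₂ = 0 := by
    ext x; simp
  rw [contr_extProd, h1, h2]
  simp

theorem contr_inr_extProd (i : I₂) (v : ExteriorAlgebra ℂ L₁) (w : ExteriorAlgebra ℂ L₂) :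
    contr ((b₁.prod b₂).coord (Sum.inr i)) (extProd L₁ L₂ (v ⊗ₜ w)) =
      extProd L₁ L₂ (parity L₁ v ⊗ₜ contr (b₂.coord i) w) := by
  have h1 : (b₁.prod b₂).coord (Sum.inr i) ∘ₗ LinearMap.inl ℂ L₁ L₂ = 0 := by
    ext x; simp
  have h2 : (b₁.prod b₂).coord (Sum.inr i) ∘ₗ LinearMap.inr ℂ L₁ L₂ = b₂.coord i := by
    ext x; simp
  rw [contr_extProd, h1, h2]
  simp

theorem prod_inl_eq (i : I₁) : b₁.prod b₂ (Sum.inl i) = (b₁ i, 0) :=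
  Prod.ext (Module.Basis.prod_apply_inl_fst _ _ _) (Module.Basis.prod_apply_inl_snd _ _ _)

theorem prod_inr_eq (i : I₂) : b₁.prod b₂ (Sum.inr i) = (0, b₂ i) :=
  Prod.ext (Module.Basis.prod_apply_inr_fst _ _ _) (Module.Basis.prod_apply_inr_snd _ _ _)

variable [Fintype I₁] [Fintype I₂]

theorem adDer_inl_extProd (x : L₁) (v : ExteriorAlgebra ℂ L₁) (w : ExteriorAlgebra ℂ L₂) :
    adDer (b₁.prod b₂) (x, 0) (extProd L₁ L₂ (v ⊗ₜ w)) =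
      extProd L₁ L₂ (adDer b₁ x v ⊗ₜ w) := by
  simp only [adDer_apply, Fintype.sum_sum_type, contr_inl_extProd, contr_inr_extProd,
    LieAlgebra.Prod.bracket_apply, Module.Basis.prod_apply_inl_fst,
    Module.Basis.prod_apply_inr_fst, lie_zero, zero_lie, Prod.mk_zero_zero, map_zero,
    LinearMap.zero_apply, Finset.sum_const_zero, add_zero, wedge_inl_extProd,
    TensorProduct.sum_tmul, map_sum]

theorem adDer_inr_extProd (y : L₂) (v : ExteriorAlgebra ℂ L₁) (w : ExteriorAlgebra ℂ L₂) :
    adDer (b₁.prod b₂) (0, y) (extProd L₁ L₂ (v ⊗ₜ w)) =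
      extProd L₁ L₂ (v ⊗ₜ adDer b₂ y w) := by
  simp only [adDer_apply, Fintype.sum_sum_type, contr_inl_extProd, contr_inr_extProd,
    LieAlgebra.Prod.bracket_apply, Module.Basis.prod_apply_inl_snd,
    Module.Basis.prod_apply_inr_snd, lie_zero, zero_lie,
    Prod.mk_zero_zero, map_zero, LinearMap.zero_apply, Finset.sum_const_zero, zero_add,
    wedge_inr_extProd, parity_parity, TensorProduct.tmul_sum, map_sum]

/-- Brackets between the two factors vanish, so there are no mixed terms and the result is the
graded tensor product of the two differentials. -/
theorem extDiff_extProd (v : ExteriorAlgebra ℂ L₁) (w : ExteriorAlgebra ℂ L₂) :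
    extDiff (b₁.prod b₂) (extProd L₁ L₂ (v ⊗ₜ w)) =
      extProd L₁ L₂ (extDiff b₁ v ⊗ₜ w) + extProd L₁ L₂ (parity L₁ v ⊗ₜ extDiff b₂ w) := by
  simp only [extDiff_apply, Fintype.sum_sum_type, contr_inl_extProd, contr_inr_extProd,
    prod_inl_eq, prod_inr_eq, adDer_inl_extProd, adDer_inr_extProd, smul_add,
    ← TensorProduct.smul_tmul', TensorProduct.tmul_smul, map_smul, TensorProduct.sum_tmul,
    TensorProduct.tmul_sum, map_sum]

theorem totalDiff_extProd {K : Type*} [AddCommGroup K] [Module ℂ K]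
    (A : L₁ × L₂ →ₗ[ℂ] K →ₗ[ℂ] K) (k : K) (v : ExteriorAlgebra ℂ L₁)
    (w : ExteriorAlgebra ℂ L₂) :
    totalDiff (b₁.prod b₂) A ((extProd L₁ L₂).lTensor K (k ⊗ₜ (v ⊗ₜ w))) =
      (extProd L₁ L₂).lTensor K
        (∑ i, A (b₁ i, 0) k ⊗ₜ (contr (b₁.coord i) v ⊗ₜ w) + k ⊗ₜ (extDiff b₁ v ⊗ₜ w) +
          (∑ i, A (0, b₂ i) k ⊗ₜ (parity L₁ v ⊗ₜ contr (b₂.coord i) w) +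
            k ⊗ₜ (parity L₁ v ⊗ₜ extDiff b₂ w))) := by
  simp only [LinearMap.lTensor_tmul, totalDiff_tmul, Fintype.sum_sum_type, contr_inl_extProd,
    contr_inr_extProd, prod_inl_eq, prod_inr_eq, extDiff_extProd, map_add, map_sum,
    TensorProduct.tmul_add]
  abel

end ExteriorProd

/-! ### Hilbert space models of `H ⊗ V` for finite-dimensional `V`. -/

section HilbertModel

open ContinuousLinearMap

theorem selfExact_congr {T Z : Type*} [Zero T] [Zero Z] {D : T → T} {D' : Z → Z} (e : T → Z)
    (he : Function.Bijective e) (h0 : e 0 = 0) (h : ∀ t, e (D t) = D' (e t)) :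
    SelfExact D ↔ SelfExact D' := by
  constructor
  · intro hD z hz
    obtain ⟨t, rfl⟩ := he.2 z
    rw [← h, ← h0] at hz
    obtain ⟨s, hs⟩ := hD t (he.1 hz)
    exact ⟨e s, by rw [← h, hs]⟩
  · intro hD t ht
    obtain ⟨z, hz⟩ := hD (e t) (by rw [← h, ht, h0])
    obtain ⟨s, rfl⟩ := he.2 z
    exact ⟨s, he.1 (by rw [h, hz])⟩

/-- The Hilbert space of families of elements of `H`, a model of `H ⊗ V` for a space `V` with a
basis indexed by `S`. -/
abbrev HilbertModel (H S : Type*) [NormedAddCommGroup H] : Type _ := PiLp 2 (fun _ : S => H)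

variable {H : Type*} [NormedAddCommGroup H] [InnerProductSpace ℂ H]
  {S : Type*} [Fintype S] [DecidableEq S] {V : Type*} [AddCommGroup V] [Module ℂ V]
  (β : Module.Basis S ℂ V)

/-- The inclusion of a coordinate. -/
def modelIns (H : Type*) [NormedAddCommGroup H] [InnerProductSpace ℂ H] {S : Type*} [Fintype S]
    [DecidableEq S] (s : S) : H →L[ℂ] HilbertModel H S :=
  (PiLp.continuousLinearEquiv 2 ℂ (fun _ : S => H)).symm.toContinuousLinearMap ∘L
    ContinuousLinearMap.single ℂ (fun _ : S => H) s

/-- The projection to a coordinate. -/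
def modelProj (H : Type*) [NormedAddCommGroup H] [InnerProductSpace ℂ H] {S : Type*} [Fintype S]
    (s : S) : HilbertModel H S →L[ℂ] H := PiLp.proj 2 (fun _ : S => H) s

theorem modelProj_comp_modelIns (s t : S) :
    modelProj H s ∘L modelIns H t = if s = t then .id ℂ H else 0 := by
  ext e
  split_ifs with h
  · subst h; simp [modelProj, modelIns]
  · simp [modelProj, modelIns, h]

theorem sum_modelIns_comp_modelProj :
    ∑ s : S, modelIns H s ∘L modelProj H s = .id ℂ (HilbertModel H S) := by
  ext x t
  simp [modelProj, modelIns, Finset.sum_apply, Pi.single_apply]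

/-- The bounded operator `e ↦ e ⊗ v` in the Hilbert space model of `H ⊗ V`. -/
def modelMk (H : Type*) [NormedAddCommGroup H] [InnerProductSpace ℂ H] :
    V →ₗ[ℂ] (H →L[ℂ] HilbertModel H S) :=
  ∑ s, (β.coord s).smulRight (modelIns H s)

theorem modelMk_apply (v : V) : modelMk β H v = ∑ s, β.coord s v • modelIns H s := by
  simp [modelMk]

theorem modelMk_basis (s : S) : modelMk β H (β s) = modelIns H s := by
  rw [modelMk_apply, Finset.sum_eq_single s]
  · simp
  · intro t _ ht
    have h0 : β.coord t (β s) = 0 := by simp [ht.symm]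
    rw [h0]
    exact ContinuousLinearMap.ext fun x => zero_smul ℂ (modelIns H t x)
  · simp

theorem modelProj_comp_modelMk (s : S) (v : V) :
    modelProj H s ∘L modelMk β H v = β.coord s v • .id ℂ H := by
  rw [modelMk_apply, ContinuousLinearMap.comp_finsetSum, Finset.sum_eq_single s]
  · rw [ContinuousLinearMap.comp_smul, modelProj_comp_modelIns, if_pos rfl]
  · intro t _ ht
    rw [ContinuousLinearMap.comp_smul, modelProj_comp_modelIns, if_neg ht.symm, smul_zero]
  · simp

/-- The operator `a ⊗ m` in the Hilbert space model of `H ⊗ V`. -/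
def modelOp (a : H →L[ℂ] H) (m : V →ₗ[ℂ] V) : HilbertModel H S →L[ℂ] HilbertModel H S :=
  ∑ s, modelMk β H (m (β s)) ∘L a ∘L modelProj H s

theorem modelOp_comp_modelMk (a : H →L[ℂ] H) (m : V →ₗ[ℂ] V) (v : V) :
    modelOp β a m ∘L modelMk β H v = modelMk β H (m v) ∘L a := by
  conv_rhs => rw [← β.sum_repr v]
  rw [modelOp, ContinuousLinearMap.finsetSum_comp, map_sum, map_sum,
    ContinuousLinearMap.finsetSum_comp]
  refine Finset.sum_congr rfl fun s _ => ?_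
  rw [ContinuousLinearMap.comp_assoc, ContinuousLinearMap.comp_assoc, modelProj_comp_modelMk,
    ContinuousLinearMap.comp_smul, ContinuousLinearMap.comp_smul, ContinuousLinearMap.comp_id,
    map_smul, map_smul, ContinuousLinearMap.smul_comp]
  rfl

theorem model_ext {S' T' : HilbertModel H S →L[ℂ] HilbertModel H S}
    (h : ∀ v, S' ∘L modelMk β H v = T' ∘L modelMk β H v) : S' = T' := by
  rw [← ContinuousLinearMap.comp_id S', ← ContinuousLinearMap.comp_id T',
    ← sum_modelIns_comp_modelProj, ContinuousLinearMap.comp_finsetSum,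
    ContinuousLinearMap.comp_finsetSum]
  refine Finset.sum_congr rfl fun s _ => ?_
  rw [← ContinuousLinearMap.comp_assoc, ← ContinuousLinearMap.comp_assoc, ← modelMk_basis β, h]

/-- The identification of `H ⊗ V` with its Hilbert space model. -/
def modelMap (H : Type*) [NormedAddCommGroup H] [InnerProductSpace ℂ H] :
    H ⊗[ℂ] V →ₗ[ℂ] HilbertModel H S :=
  TensorProduct.lift ((ContinuousLinearMap.coeLM ℂ ∘ₗ modelMk β H).flip)

theorem modelMap_tmul (e : H) (v : V) : modelMap β H (e ⊗ₜ v) = modelMk β H v e := rfl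

theorem modelMap_bijective : Function.Bijective (modelMap β H) := by
  refine Function.bijective_iff_has_inverse.mpr
    ⟨fun x => ∑ s, modelProj H s x ⊗ₜ β s, fun t => ?_, fun x => ?_⟩
  · induction t with
    | zero => simp
    | add s t hs ht =>
      simp only [map_add, TensorProduct.add_tmul, Finset.sum_add_distrib] at hs ht ⊢
      rw [hs, ht]
    | tmul e v =>
      have h : ∀ s, modelProj H s (modelMk β H v e) = β.coord s v • e := fun s =>
        congrArg (fun T => T e) (modelProj_comp_modelMk β s v)
      simp only [modelMap_tmul, h, TensorProduct.smul_tmul, ← TensorProduct.tmul_sum,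
        Module.Basis.coord_apply, β.sum_repr]
  · simp only [map_sum, modelMap_tmul, modelMk_basis]
    have := congrArg (fun T => T x) (sum_modelIns_comp_modelProj (H := H) (S := S))
    simpa [_root_.sum_apply] using this

section Product

variable {H' : Type*} [NormedAddCommGroup H'] [InnerProductSpace ℂ H']
  {S' : Type*} [Fintype S'] [DecidableEq S'] {V' : Type*} [AddCommGroup V'] [Module ℂ V']
  (β' : Module.Basis S' ℂ V')

/-- The identification of `(H ⊗ H') ⊗ (V ⊗ V')` with the Hilbert tensor product of the models of
`H ⊗ V` and `H' ⊗ V'`. -/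
def modelProdMap (H H' : Type*) [NormedAddCommGroup H] [InnerProductSpace ℂ H]
    [NormedAddCommGroup H'] [InnerProductSpace ℂ H'] :
    HilbertTensor H H' ⊗[ℂ] (V ⊗[ℂ] V') →ₗ[ℂ]
      HilbertTensor (HilbertModel H S) (HilbertModel H' S') :=
  TensorProduct.lift ((ContinuousLinearMap.coeLM ℂ ∘ₗ TensorProduct.lift
    ((tensorMapₗ H (HilbertModel H S) H' (HilbertModel H' S')).compl₁₂
      (modelMk β H) (modelMk β' H'))).flip)

theorem modelProdMap_tmul (k : HilbertTensor H H') (v : V) (v' : V') :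
    modelProdMap β β' H H' (k ⊗ₜ (v ⊗ₜ v')) = tensorMap (modelMk β H v) (modelMk β' H' v') k := rfl

/-- `V` and `V'` have finite bases, so tensoring with them commutes with completion; the inverse
reads off coordinates with the completed projections. -/
theorem modelProdMap_bijective : Function.Bijective (modelProdMap β β' H H') := by
  refine Function.bijective_iff_has_inverse.mpr
    ⟨fun x => ∑ s, ∑ s', tensorMap (modelProj H s) (modelProj H' s') x ⊗ₜ (β s ⊗ₜ β' s'),
      fun t => ?_, fun x => ?_⟩
  · induction t with
    | zero => simp
    | add s t hs ht =>
      simp only [map_add, TensorProduct.add_tmul, Finset.sum_add_distrib] at hs ht ⊢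
      rw [hs, ht]
    | tmul k z =>
      induction z with
      | zero => simp
      | add s t hs ht =>
        simp only [map_add, TensorProduct.tmul_add, TensorProduct.add_tmul,
          Finset.sum_add_distrib] at hs ht ⊢
        rw [hs, ht]
      | tmul v v' =>
        simp only [modelProdMap_tmul, tensorMap_apply_apply, modelProj_comp_modelMk,
          tensorMap_smul_left, tensorMap_smul_right, tensorMap_id, smul_apply,
          ContinuousLinearMap.id_apply, TensorProduct.smul_tmul, ← TensorProduct.tmul_sum,
          ← TensorProduct.tmul_smul, ← Finset.smul_sum, Module.Basis.coord_apply, β'.sum_repr]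
        simp only [← TensorProduct.smul_tmul, ← TensorProduct.sum_tmul, β.sum_repr]
  · simp only [map_sum, modelProdMap_tmul, modelMk_basis, tensorMap_apply_apply]
    simp only [← _root_.sum_apply, ← tensorMapₗ_apply, ← map_sum,
      sum_modelIns_comp_modelProj, ← LinearMap.sum_apply]
    rw [tensorMapₗ_apply, tensorMap_id]
    rfl

end Product

end HilbertModel

/-! ### The Künneth criterion for Koszul complexes and the joint spectrum of a product. -/

section KoszulKunneth

open ContinuousLinearMap

variable {L : Type*} [LieRing L] [LieAlgebra ℂ L] {I : Type*} [Fintype I]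
  {H : Type*} [NormedAddCommGroup H] [InnerProductSpace ℂ H]
  {S : Type*} [Fintype S] [DecidableEq S]

/-- The total Koszul differential in a Hilbert space model. -/
def modelDiff (b : Module.Basis I ℂ L) (β : Module.Basis S ℂ (ExteriorAlgebra ℂ L))
    (a : L →ₗ[ℂ] (H →L[ℂ] H)) : HilbertModel H S →L[ℂ] HilbertModel H S :=
  ∑ i, modelOp β (a (b i)) (contr (b.coord i)) + modelOp β (.id ℂ H) (extDiff b)

variable (b : Module.Basis I ℂ L) (β : Module.Basis S ℂ (ExteriorAlgebra ℂ L))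
  (a : L →ₗ[ℂ] (H →L[ℂ] H))

theorem modelDiff_comp_modelMk (v : ExteriorAlgebra ℂ L) :
    modelDiff b β a ∘L modelMk β H v =
      ∑ i, modelMk β H (contr (b.coord i) v) ∘L a (b i) + modelMk β H (extDiff b v) := by
  simp only [modelDiff, ContinuousLinearMap.add_comp, ContinuousLinearMap.finsetSum_comp,
    modelOp_comp_modelMk, ContinuousLinearMap.comp_id]

theorem modelMap_totalDiff (t : H ⊗[ℂ] ExteriorAlgebra ℂ L) :
    modelMap β H (totalDiff b (coeLM ℂ ∘ₗ a) t) = modelDiff b β a (modelMap β H t) := by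
  induction t with
  | zero => simp
  | add s t hs ht => simp only [map_add, hs, ht]
  | tmul e v =>
    have h := congrArg (fun T => T e) (modelDiff_comp_modelMk b β a v)
    simp only [ContinuousLinearMap.comp_apply, add_apply, _root_.sum_apply] at h
    simp only [totalDiff_tmul, map_add, map_sum, modelMap_tmul, h]
    rfl

theorem selfExact_modelDiff_iff :
    SelfExact (modelDiff b β a) ↔ SelfExact (totalDiff b (coeLM ℂ ∘ₗ a)) :=
  (selfExact_congr (modelMap β H) (modelMap_bijective β) (map_zero _)
    (modelMap_totalDiff b β a)).symm

theorem modelDiff_modelDiff (ha : ∀ x y e, a ⁅x, y⁆ e = a y (a x e) - a x (a y e))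
    (x : HilbertModel H S) : modelDiff b β a (modelDiff b β a x) = 0 := by
  obtain ⟨t, rfl⟩ := (modelMap_bijective β).2 x
  rw [← modelMap_totalDiff, ← modelMap_totalDiff, totalDiff_totalDiff b _ ha, map_zero]

/-- The parity operator in a Hilbert space model. -/
def modelParity (H : Type*) [NormedAddCommGroup H] [InnerProductSpace ℂ H] :
    HilbertModel H S →L[ℂ] HilbertModel H S :=
  modelOp β (.id ℂ H) (parity L)

theorem modelParity_comp_modelMk (v : ExteriorAlgebra ℂ L) :
    modelParity β H ∘L modelMk β H v = modelMk β H (parity L v) := by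
  rw [modelParity, modelOp_comp_modelMk, ContinuousLinearMap.comp_id]

theorem modelParity_comp_self : modelParity β H ∘L modelParity β H = .id ℂ _ := by
  refine model_ext β fun v => ?_
  rw [ContinuousLinearMap.comp_assoc, modelParity_comp_modelMk, modelParity_comp_modelMk,
    parity_parity, ContinuousLinearMap.id_comp]

theorem modelParity_comp_modelDiff :
    modelParity β H ∘L modelDiff b β a = - (modelDiff b β a ∘L modelParity β H) := by
  refine model_ext β fun v => ?_
  rw [ContinuousLinearMap.comp_assoc, ContinuousLinearMap.neg_comp, ContinuousLinearMap.comp_assoc,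
    modelParity_comp_modelMk, modelDiff_comp_modelMk, modelDiff_comp_modelMk,
    ContinuousLinearMap.comp_add, ContinuousLinearMap.comp_finsetSum, modelParity_comp_modelMk]
  simp only [← ContinuousLinearMap.comp_assoc, modelParity_comp_modelMk, contr_parity,
    extDiff_parity, map_neg, ContinuousLinearMap.neg_comp, Finset.sum_neg_distrib]
  abel

variable {L' : Type*} [LieRing L'] [LieAlgebra ℂ L'] {I' : Type*} [Fintype I']
  {H' : Type*} [NormedAddCommGroup H'] [InnerProductSpace ℂ H']
  {S' : Type*} [Fintype S'] [DecidableEq S']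
  (b' : Module.Basis I' ℂ L') (β' : Module.Basis S' ℂ (ExteriorAlgebra ℂ L'))
  (a' : L' →ₗ[ℂ] (H' →L[ℂ] H'))

/-- The two complexes are compared through `(H ⊗ H') ⊗ (⋀L ⊗ ⋀L')`. The differential on this middle
space is left unnamed; `u` is its value at `t`. -/
theorem exists_totalDiff_extProd
    (A : L × L' →ₗ[ℂ] HilbertTensor H H' →ₗ[ℂ] HilbertTensor H H')
    (hA : ∀ x k, A (x, 0) k = tensorMap (a x) (.id ℂ H') k)
    (hA' : ∀ y k, A (0, y) k = tensorMap (.id ℂ H) (a' y) k)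
    (t : HilbertTensor H H' ⊗[ℂ] (ExteriorAlgebra ℂ L ⊗[ℂ] ExteriorAlgebra ℂ L')) :
    ∃ u, totalDiff (b.prod b') A ((extProd L L').lTensor _ t) = (extProd L L').lTensor _ u ∧
      modelProdMap β β' H H' u =
        tensorDiff (modelDiff b β a) (modelParity β H) (modelDiff b' β' a')
          (modelProdMap β β' H H' t) := by
  induction t with
  | zero => exact ⟨0, by simp, by simp⟩
  | add s t hs ht =>
    obtain ⟨u, hu, hu'⟩ := hs
    obtain ⟨w, hw, hw'⟩ := ht
    exact ⟨u + w, by simp only [map_add, hu, hw], by simp only [map_add, hu', hw']⟩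
  | tmul k z =>
    induction z with
    | zero => exact ⟨0, by simp, by simp⟩
    | add s t hs ht =>
      obtain ⟨u, hu, hu'⟩ := hs
      obtain ⟨w, hw, hw'⟩ := ht
      exact ⟨u + w, by simp only [TensorProduct.tmul_add, map_add, hu, hw],
        by simp only [TensorProduct.tmul_add, map_add, hu', hw']⟩
    | tmul v w =>
      refine ⟨_, totalDiff_extProd b b' A k v w, ?_⟩
      simp only [map_add, map_sum, modelProdMap_tmul, hA, hA', tensorDiff, add_apply,
        tensorMap_apply_apply, modelDiff_comp_modelMk, modelParity_comp_modelMk,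
        ContinuousLinearMap.id_comp, ContinuousLinearMap.comp_id]
      simp only [← tensorMapₗ_apply, map_add, map_sum, LinearMap.add_apply, LinearMap.sum_apply,
        add_apply, _root_.sum_apply]

theorem selfExact_totalDiff_prod_iff_tensorDiff [FiniteDimensional ℂ L] [FiniteDimensional ℂ L']
    (A : L × L' →ₗ[ℂ] HilbertTensor H H' →ₗ[ℂ] HilbertTensor H H')
    (hA : ∀ x k, A (x, 0) k = tensorMap (a x) (.id ℂ H') k)
    (hA' : ∀ y k, A (0, y) k = tensorMap (.id ℂ H) (a' y) k) :
    SelfExact (totalDiff (b.prod b') A) ↔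
      SelfExact (tensorDiff (modelDiff b β a) (modelParity β H) (modelDiff b' β' a')) := by
  let e : ExteriorAlgebra ℂ L ⊗[ℂ] ExteriorAlgebra ℂ L' ≃ₗ[ℂ] ExteriorAlgebra ℂ (L × L') :=
    LinearEquiv.ofBijective (extProd L L') extProd_bijective
  let M := e.lTensor (HilbertTensor H H')
  refine selfExact_congr (fun t => modelProdMap β β' H H' (M.symm t))
    ((modelProdMap_bijective β β').comp M.symm.bijective) (by simp only [map_zero]) fun t => ?_
  obtain ⟨u, hu, hu'⟩ := exists_totalDiff_extProd b β a b' β' a' A hA hA' (M.symm t)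
  have h1 : totalDiff (b.prod b') A (M (M.symm t)) = M u := hu
  rw [M.apply_symm_apply] at h1
  rw [← hu']
  exact congrArg _ (by rw [h1, M.symm_apply_apply])

/-- **Künneth** for Koszul complexes: the Koszul complex of a product on a Hilbert tensor product is
exact if and only if one of the two Koszul complexes is. -/
theorem selfExact_totalDiff_prod_iff [CompleteSpace H] [CompleteSpace H']
    (A : L × L' →ₗ[ℂ] HilbertTensor H H' →ₗ[ℂ] HilbertTensor H H')
    (hA : ∀ x k, A (x, 0) k = tensorMap (a x) (.id ℂ H') k)
    (hA' : ∀ y k, A (0, y) k = tensorMap (.id ℂ H) (a' y) k)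
    (ha : ∀ x y e, a ⁅x, y⁆ e = a y (a x e) - a x (a y e))
    (ha' : ∀ x y e, a' ⁅x, y⁆ e = a' y (a' x e) - a' x (a' y e)) :
    SelfExact (totalDiff (b.prod b') A) ↔
      SelfExact (totalDiff b (coeLM ℂ ∘ₗ a)) ∨ SelfExact (totalDiff b' (coeLM ℂ ∘ₗ a')) := by
  have hfin : FiniteDimensional ℂ L := b.finiteDimensional_of_finite
  have hfin' : FiniteDimensional ℂ L' := b'.finiteDimensional_of_finite
  have := finite_exteriorAlgebra L
  have := finite_exteriorAlgebra L'
  have β := Module.finBasis ℂ (ExteriorAlgebra ℂ L)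
  have β' := Module.finBasis ℂ (ExteriorAlgebra ℂ L')
  have h1 := selfExact_totalDiff_prod_iff_tensorDiff b β a b' β' a' A hA hA'
  have h2 := selfExact_tensorDiff_iff (modelDiff b β a) (modelParity β H) (modelDiff b' β' a')
    (modelParity_comp_self β) (modelParity_comp_modelDiff b β a) (modelDiff_modelDiff b β a ha)
    (modelDiff_modelDiff b' β' a' ha')
  exact h1.trans (h2.trans
    (or_congr (selfExact_modelDiff_iff b β a) (selfExact_modelDiff_iff b' β' a')))

/-- The bounded operators `e ↦ e (x - f x)`. -/
def shiftL (ρ : L →ₗ⁅ℂ⁆ (H →L[ℂ] H)ᵐᵒᵖ) (f : Module.Dual ℂ L) : L →ₗ[ℂ] (H →L[ℂ] H) where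
  toFun x := (ρ x).unop - f x • .id ℂ H
  map_add' x y := by
    simp only [map_add, MulOpposite.unop_add, add_smul]
    abel
  map_smul' c x := by
    simp only [map_smul, MulOpposite.unop_smul, smul_eq_mul, mul_smul, smul_sub, RingHom.id_apply]

theorem shift_apply (ρ : L →ₗ⁅ℂ⁆ (H →L[ℂ] H)ᵐᵒᵖ) (f : Module.Dual ℂ L) (x : L) (e : H) :
    shift ρ f x e = (ρ x).unop e - f x • e := rfl

theorem shiftL_apply (ρ : L →ₗ⁅ℂ⁆ (H →L[ℂ] H)ᵐᵒᵖ) (f : Module.Dual ℂ L) (x : L) :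
    shiftL ρ f x = (ρ x).unop - f x • .id ℂ H := rfl

theorem character_prod_iff (f : Module.Dual ℂ (L × L')) : (∀ z w : L × L', f ⁅z, w⁆ = 0) ↔
      (∀ x y : L, (f ∘ₗ LinearMap.inl ℂ L L') ⁅x, y⁆ = 0) ∧
        (∀ x y : L', (f ∘ₗ LinearMap.inr ℂ L L') ⁅x, y⁆ = 0) := by
  constructor
  · refine fun h => ⟨fun x y => ?_, fun x y => ?_⟩
    · simpa using h (x, 0) (y, 0)
    · simpa using h (0, x) (0, y)
  · rintro ⟨h1, h2⟩ z w
    have h3 := congrArg₂ (· + ·) (h1 z.1 w.1) (h2 z.2 w.2)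
    simp only [LinearMap.comp_apply, LinearMap.inl_apply, LinearMap.inr_apply, ← map_add,
      Prod.mk_add_mk, zero_add, add_zero] at h3
    exact h3

/-- The joint spectrum of a product of Lie algebras acting on a Hilbert tensor product. -/
theorem mem_jointSpectrum_prod_iff [CompleteSpace H] [CompleteSpace H'] [FiniteDimensional ℂ L]
    [FiniteDimensional ℂ L'] (ρ : L →ₗ⁅ℂ⁆ (H →L[ℂ] H)ᵐᵒᵖ) (ρ' : L' →ₗ⁅ℂ⁆ (H' →L[ℂ] H')ᵐᵒᵖ)
    (P : L × L' →ₗ⁅ℂ⁆ (HilbertTensor H H' →L[ℂ] HilbertTensor H H')ᵐᵒᵖ)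
    (hP : ∀ x, (P (x, 0)).unop = tensorMap (ρ x).unop (.id ℂ H'))
    (hP' : ∀ y, (P (0, y)).unop = tensorMap (.id ℂ H) (ρ' y).unop)
    (f : Module.Dual ℂ (L × L')) : f ∈ jointSpectrum P ↔
      f ∘ₗ LinearMap.inl ℂ L L' ∈ jointSpectrum ρ ∧
        f ∘ₗ LinearMap.inr ℂ L L' ∈ jointSpectrum ρ' := by
  have b := Module.finBasis ℂ L
  have b' := Module.finBasis ℂ L'
  rw [mem_jointSpectrum_iff (b.prod b') P f, mem_jointSpectrum_iff b ρ,
    mem_jointSpectrum_iff b' ρ', character_prod_iff, and_and_and_comm, and_congr_right_iff]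
  rintro ⟨h1, h2⟩
  rw [← not_or, not_iff_not]
  -- The scalar `f (x, 0)` is absorbed by the first factor and `f (0, y)` by the second, so the
  -- shifted action of the product comes from the two shifted actions.
  refine selfExact_totalDiff_prod_iff b (shiftL ρ _) b' (shiftL ρ' _) _ (fun x k => ?_)
    (fun y k => ?_) (shift_lie ρ h1) (shift_lie ρ' h2)
  · rw [shift_apply, hP, shiftL_apply, ← tensorMapₗ_apply, ← tensorMapₗ_apply, map_sub, map_smul,
      LinearMap.sub_apply, LinearMap.smul_apply, tensorMapₗ_apply, tensorMapₗ_apply, tensorMap_id]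
    rfl
  · rw [shift_apply, hP', shiftL_apply, ← tensorMapₗ_apply, ← tensorMapₗ_apply, map_sub, map_smul,
      tensorMapₗ_apply, tensorMapₗ_apply, tensorMap_id]
    rfl

end KoszulKunneth

/-! ### Specialization to Lie algebras of operators. -/

section ProductAction

open ContinuousLinearMap

variable {H₁ H₂ : Type*} [NormedAddCommGroup H₁] [InnerProductSpace ℂ H₁]
  [NormedAddCommGroup H₂] [InnerProductSpace ℂ H₂]
  (L₁ : LieSubalgebra ℂ (H₁ →L[ℂ] H₁)ᵐᵒᵖ) (L₂ : LieSubalgebra ℂ (H₂ →L[ℂ] H₂)ᵐᵒᵖ)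

theorem productAction_inl (x : L₁) :
    (productAction L₁ L₂ (x, 0)).unop = tensorMap x.1.unop (.id ℂ H₂) := by
  rw [← tensorOne_eq_tensorMap]; exact inclLeft_coe L₁ L₂ x

theorem productAction_inr (y : L₂) :
    (productAction L₁ L₂ (0, y)).unop = tensorMap (.id ℂ H₁) y.1.unop := by
  rw [← oneTensor_eq_tensorMap]; exact inclRight_coe L₁ L₂ y

theorem mem_jointSpectrum_productAction_iff [CompleteSpace H₁] [CompleteSpace H₂]
    [FiniteDimensional ℂ L₁] [FiniteDimensional ℂ L₂] (f : Module.Dual ℂ (L₁ × L₂)) :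
    f ∈ jointSpectrum (productAction L₁ L₂) ↔
      f ∘ₗ LinearMap.inl ℂ L₁ L₂ ∈ Sp L₁ ∧ f ∘ₗ LinearMap.inr ℂ L₁ L₂ ∈ Sp L₂ :=
  mem_jointSpectrum_prod_iff L₁.incl L₂.incl (productAction L₁ L₂) (productAction_inl L₁ L₂)
    (productAction_inr L₁ L₂) f

end ProductAction

/-! ### Koszul complexes and split central extensions. -/

section Extension

variable {L M : Type*} [LieRing L] [LieAlgebra ℂ L] [LieRing M] [LieAlgebra ℂ M]
  {I J : Type*} [Fintype I] [Fintype J] (b : Module.Basis I ℂ L) (c : Module.Basis J ℂ M)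
  {H : Type*} [AddCommGroup H] [Module ℂ H]
  {A : L →ₗ[ℂ] H →ₗ[ℂ] H} {B : M →ₗ[ℂ] H →ₗ[ℂ] H}
  (π : L →ₗ⁅ℂ⁆ M) (σ : M →ₗ⁅ℂ⁆ L)

theorem totalMap_totalMap (hσ : ∀ m, π (σ m) = m) (t : H ⊗[ℂ] ExteriorAlgebra ℂ M) :
    totalMap H π (totalMap H σ t) = t := by
  induction t using total_induction with
  | hadd s t hs ht => simp only [map_add, hs, ht]
  | hone e => simp only [totalMap_one]
  | hwedge x t ht => simp only [totalMap_wedge, ht, hσ]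

/-- Exactness of the Koszul complex passes to retracts. -/
theorem SelfExact.of_retract (hA : ∀ x, A x = B (π x)) (hσ : ∀ m, π (σ m) = m)
    (h : SelfExact (totalDiff b A)) : SelfExact (totalDiff c B) := by
  have hB : ∀ m, B m = A (σ m) := fun m => by rw [hA, hσ]
  intro t ht
  obtain ⟨s, hs⟩ := h (totalMap H σ t) (by
    rw [← totalMap_totalDiff c b σ hB, ht, map_zero])
  exact ⟨totalMap H π s, by
    rw [← totalMap_totalDiff b c π hA, hs, totalMap_totalMap π σ hσ]⟩

variable {z : L} {χ : Module.Dual ℂ L}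

/-- Because `L = σ(M) + ℂ z`, every exterior product over `L` is one over `σ(M)` plus a multiple of
`z`. -/
theorem exists_eq_totalMap_add_wedge (hx : ∀ x, x = σ (π x) + χ x • z)
    (t : H ⊗[ℂ] ExteriorAlgebra ℂ L) :
    ∃ v, t = totalMap H σ (totalMap H π t) + (wedge z).lTensor H v := by
  induction t using total_induction with
  | hadd s t hs ht =>
    obtain ⟨v, hv⟩ := hs
    obtain ⟨w, hw⟩ := ht
    refine ⟨v + w, ?_⟩
    nth_rewrite 1 [hv, hw]
    simp only [map_add]
    abel
  | hone e => exact ⟨0, by simp only [totalMap_one, map_zero, add_zero]⟩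
  | hwedge x t ht =>
    obtain ⟨v, hv⟩ := ht
    have hzx : ∀ w : H ⊗[ℂ] ExteriorAlgebra ℂ L, (wedge (σ (π x))).lTensor H ((wedge z).lTensor H w)
        = - (wedge z).lTensor H ((wedge (σ (π x))).lTensor H w) := fun w => by
      induction w with
      | zero => simp
      | add s t hs ht => simp only [map_add, hs, ht, neg_add]
      | tmul e w => simp only [LinearMap.lTensor_tmul, wedge_wedge _ z, TensorProduct.tmul_neg]
    refine ⟨χ x • t - (wedge (σ (π x))).lTensor H v, ?_⟩
    simp only [totalMap_wedge]
    nth_rewrite 1 [hx x]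
    rw [map_add, map_smul, LinearMap.lTensor_add, LinearMap.lTensor_smul, LinearMap.add_apply,
      LinearMap.smul_apply, map_sub, map_smul, ← sub_eq_zero]
    nth_rewrite 1 [hv]
    rw [map_add, hzx]
    abel

/-- Contraction with `χ` kills the forms over `σ(M)` and therefore inverts `z ∧` on them. -/
theorem totalMap_eq_zero_of_wedge (hχσ : ∀ m, χ (σ m) = 0) (hχz : χ z = 1)
    (u : H ⊗[ℂ] ExteriorAlgebra ℂ M) (hu : (wedge z).lTensor H (totalMap H σ u) = 0) :
    totalMap H σ u = 0 := by
  have hw : ∀ x (w : H ⊗[ℂ] ExteriorAlgebra ℂ L), (contr χ).lTensor H ((wedge x).lTensor H w) =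
      χ x • w - (wedge x).lTensor H ((contr χ).lTensor H w) := fun x w => by
    induction w with
    | zero => simp
    | add s t hs ht => simp only [map_add, hs, ht, smul_add]; abel
    | tmul e w =>
      simp only [LinearMap.lTensor_tmul, contr_wedge, TensorProduct.tmul_sub,
        TensorProduct.tmul_smul]
  have h0 : (contr χ).lTensor H (totalMap H σ u) = 0 := by
    clear hu
    induction u using total_induction with
    | hadd s t hs ht => simp only [map_add, hs, ht, add_zero]
    | hone e => simp only [totalMap_one, LinearMap.lTensor_tmul, contr_one, TensorProduct.tmul_zero]
    | hwedge x t ht => rw [totalMap_wedge, hw, ht, hχσ, zero_smul, map_zero, sub_zero]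
  have h1 := hw z (totalMap H σ u)
  rwa [hu, h0, hχz, map_zero, map_zero, one_smul, sub_zero, eq_comm] at h1

theorem wedge_wedge_self_lTensor (w : H ⊗[ℂ] ExteriorAlgebra ℂ L) :
    (wedge z).lTensor H ((wedge z).lTensor H w) = 0 := by
  induction w with
  | zero => simp
  | add s t hs ht => simp only [map_add, hs, ht, add_zero]
  | tmul e w =>
    simp only [LinearMap.lTensor_tmul, wedge_apply, ← mul_assoc, ExteriorAlgebra.ι_sq_zero,
      zero_mul, TensorProduct.tmul_zero]

/-- Exactness of the Koszul complex of a quotient by a split central line acting trivially passes to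
the Koszul complex of the Lie algebra. -/
theorem SelfExact.of_split_central (hA : ∀ x, A x = B (π x)) (hσ : ∀ m, π (σ m) = m)
    (hπz : π z = 0) (hz : ∀ y : L, ⁅z, y⁆ = 0) (hx : ∀ x, x = σ (π x) + χ x • z)
    (hχσ : ∀ m, χ (σ m) = 0) (hχz : χ z = 1) (h : SelfExact (totalDiff c B)) :
    SelfExact (totalDiff b A) := by
  have hB : ∀ m, B m = A (σ m) := fun m => by rw [hA, hσ]
  have hAz : A z = (0 : ℂ) • LinearMap.id := by rw [hA, hπz, map_zero, zero_smul]
  have hDz : ∀ t, totalDiff b A ((wedge z).lTensor H t) =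
      - (wedge z).lTensor H (totalDiff b A t) := fun t => by
    rw [totalDiff_wedge, lieDer_of_central b A hz hAz, zero_smul, zero_sub]
  intro w hw
  have hQ : totalDiff c B (totalMap H π w) = 0 := by
    rw [← totalMap_totalDiff b c π hA, hw, map_zero]
  obtain ⟨v, hv⟩ := h _ hQ
  obtain ⟨w₁, hw₁⟩ := exists_eq_totalMap_add_wedge π σ hx w
  -- Decomposing again puts the coefficient of `z` over `σ(M)`, since `z ∧ z = 0` removes the new
  -- remainder.
  obtain ⟨w₂, hw₂⟩ := exists_eq_totalMap_add_wedge π σ hx w₁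
  have h1 : w = totalMap H σ (totalMap H π w) +
      (wedge z).lTensor H (totalMap H σ (totalMap H π w₁)) := by
    nth_rewrite 1 [hw₁]
    nth_rewrite 1 [hw₂]
    rw [map_add, wedge_wedge_self_lTensor, add_zero]
  have h2 : (wedge z).lTensor H (totalMap H σ (totalDiff c B (totalMap H π w₁))) = 0 := by
    have h3 := congrArg (totalDiff b A) h1
    rw [hw, map_add, ← totalMap_totalDiff c b σ hB, hQ, map_zero, zero_add, hDz,
      ← totalMap_totalDiff c b σ hB, eq_comm, neg_eq_zero] at h3
    exact h3
  have h4 := totalMap_eq_zero_of_wedge σ hχσ hχz _ h2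
  have h5 : totalDiff c B (totalMap H π w₁) = 0 := by
    rw [← totalMap_totalMap π σ hσ (totalDiff c B (totalMap H π w₁)), h4, map_zero]
  obtain ⟨u, hu⟩ := h _ h5
  -- Both components of `w` come from cycles over `M`, with preimages `v` and `u`. The minus sign
  -- compensates for the differential anticommuting with `z ∧`.
  refine ⟨totalMap H σ v - (wedge z).lTensor H (totalMap H σ u), ?_⟩
  rw [map_sub, hDz, ← totalMap_totalDiff c b σ hB, ← totalMap_totalDiff c b σ hB, hv, hu,
    sub_neg_eq_add, ← h1]

/-- A surjective Lie homomorphism that is injective on the kernel of a suitable character has a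
section with values in this kernel. -/
theorem exists_lieHom_section (hπ : Function.Surjective π) (hπz : π z = 0)
    (hinj : ∀ x, π x = 0 → χ x = 0 → x = 0) (hχz : ∀ x, χ x * χ z = χ x)
    (hχ : ∀ x y : L, χ ⁅x, y⁆ = 0) :
    ∃ σ : M →ₗ⁅ℂ⁆ L, (∀ m, π (σ m) = m) ∧ (∀ m, χ (σ m) = 0) ∧ ∀ x, x = σ (π x) + χ x • z := by
  -- Elements of `L` are determined by their images under `π` and `χ`, so linearity and
  -- multiplicativity of the section need only be tested there.
  have huniq : ∀ x y, π x = π y → χ x = χ y → x = y := fun x y h h' =>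
    sub_eq_zero.mp (hinj _ (by rw [map_sub, h, sub_self]) (by rw [map_sub, h', sub_self]))
  have hex : ∀ m, ∃ x, π x = m ∧ χ x = 0 := fun m => by
    obtain ⟨x, rfl⟩ := hπ m
    refine ⟨x - χ x • z, by rw [map_sub, map_smul, hπz, smul_zero, sub_zero], ?_⟩
    rw [map_sub, map_smul, smul_eq_mul, hχz, sub_self]
  choose s hs hs' using hex
  refine ⟨{ toFun := s, map_add' := fun x y => huniq _ _ ?_ ?_, map_smul' := fun r x => huniq _ _ ?_ ?_,
            map_lie' := huniq _ _ ?_ ?_ }, hs, hs', fun x => huniq _ _ ?_ ?_⟩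
  · rw [map_add, hs, hs, hs]
  · rw [map_add, hs', hs', hs', add_zero]
  · rw [RingHom.id_apply, map_smul, hs, hs]
  · rw [RingHom.id_apply, map_smul, hs', hs', smul_zero]
  · rw [LieHom.map_lie, hs, hs, hs]
  · rw [hs', hχ]
  · rw [map_add, map_smul, hπz, smul_zero, add_zero]
    exact (hs _).symm
  · rw [map_add, map_smul, smul_eq_mul, hχz]
    exact (by rw [hs', zero_add] : χ x = χ (s (π x)) + χ x)

end Extension

/-! ### Joint spectra under quotients of the acting Lie algebra. -/

section Quotient

variable {L M : Type*} [LieRing L] [LieAlgebra ℂ L] [LieRing M] [LieAlgebra ℂ M]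
  {H : Type*} [NormedAddCommGroup H] [InnerProductSpace ℂ H]
  {P : L →ₗ⁅ℂ⁆ (H →L[ℂ] H)ᵐᵒᵖ} {ρ : M →ₗ⁅ℂ⁆ (H →L[ℂ] H)ᵐᵒᵖ} (π : L →ₗ⁅ℂ⁆ M)

theorem character_comp_iff (hπ : Function.Surjective π) (f : Module.Dual ℂ M) :
    (∀ x y : L, (f ∘ₗ (π : L →ₗ[ℂ] M)) ⁅x, y⁆ = 0) ↔ ∀ x y : M, f ⁅x, y⁆ = 0 := by
  have h : ∀ x y : L, (f ∘ₗ (π : L →ₗ[ℂ] M)) ⁅x, y⁆ = f ⁅π x, π y⁆ := fun x y => by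
    rw [← LieHom.map_lie]; rfl
  simp only [h]
  exact ⟨fun H x y => by
    obtain ⟨x, rfl⟩ := hπ x
    obtain ⟨y, rfl⟩ := hπ y
    exact H x y, fun H x y => H _ _⟩

theorem shift_comp (hP : ∀ x, P x = ρ (π x)) (f : Module.Dual ℂ M) (x : L) :
    shift P (f ∘ₗ (π : L →ₗ[ℂ] M)) x = shift ρ f (π x) := by
  ext e
  rw [shift_apply, shift_apply, hP]
  rfl

variable [FiniteDimensional ℂ L]

/-- A point of the joint spectrum takes the value `c` on a central element that acts as the scalar
`c`. -/
theorem apply_eq_of_mem_jointSpectrum {f : Module.Dual ℂ L} (hf : f ∈ jointSpectrum P) {z : L}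
    (hz : ∀ y : L, ⁅z, y⁆ = 0) {c : ℂ} (hc : (P z).unop = c • .id ℂ H) : f z = c := by
  by_contra hne
  refine ((mem_jointSpectrum_iff (Module.finBasis ℂ L) P f).mp hf).2
    (selfExact_of_central _ _ hz (c := c - f z) ?_ (sub_ne_zero.mpr (Ne.symm hne)))
  ext e
  rw [shift_apply, hc, LinearMap.smul_apply, LinearMap.id_apply, sub_smul]
  rfl

variable [FiniteDimensional ℂ M]

theorem mem_jointSpectrum_comp_iff_of_bijective (hP : ∀ x, P x = ρ (π x))
    (hπ : Function.Bijective π)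
    (f : Module.Dual ℂ M) :
    f ∘ₗ (π : L →ₗ[ℂ] M) ∈ jointSpectrum P ↔ f ∈ jointSpectrum ρ := by
  -- With `z = 0` and `χ = 0` the section is the inverse of `π`; the condition `χ x * χ z = χ x` is
  -- weak enough to allow this case.
  obtain ⟨σ, hσ, -, hx⟩ := exists_lieHom_section π (z := 0) (χ := 0) hπ.2 (map_zero _)
    (fun x hx _ => hπ.1 (by rw [hx, map_zero])) (by simp) (by simp)
  have hσ' : ∀ x, σ (π x) = x := fun x => by simpa using (hx x).symm
  rw [mem_jointSpectrum_iff (Module.finBasis ℂ L), mem_jointSpectrum_iff (Module.finBasis ℂ M),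
    character_comp_iff π hπ.2]
  refine and_congr_right fun _ => not_congr
    ⟨SelfExact.of_retract _ _ π σ (shift_comp π hP f) hσ,
      SelfExact.of_retract _ _ σ π (fun m => ?_) hσ'⟩
  rw [shift_comp π hP, hσ]

/-- A character with value 1 on `z` splits off the kernel line as a Lie algebra. Exactness then
descends to `M` as a retract and ascends by `SelfExact.of_split_central`. -/
theorem mem_jointSpectrum_comp_iff_of_split (hP : ∀ x, P x = ρ (π x))
    (hπ : Function.Surjective π) {z : L}
    {χ : Module.Dual ℂ L} (hπz : π z = 0) (hker : ∀ x, π x = 0 → ∃ r : ℂ, x = r • z)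
    (hz : ∀ y : L, ⁅z, y⁆ = 0) (hχ : ∀ x y : L, χ ⁅x, y⁆ = 0) (hχz : χ z = 1)
    (f : Module.Dual ℂ M) :
    f ∘ₗ (π : L →ₗ[ℂ] M) ∈ jointSpectrum P ↔ f ∈ jointSpectrum ρ := by
  obtain ⟨σ, hσ, hχσ, hx⟩ := exists_lieHom_section π (z := z) (χ := χ) hπ hπz
    (fun x hx hx' => by
      obtain ⟨r, rfl⟩ := hker x hx
      rw [map_smul, hχz, smul_eq_mul, mul_one] at hx'
      rw [hx', zero_smul]) (fun x => by rw [hχz, mul_one]) hχ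
  rw [mem_jointSpectrum_iff (Module.finBasis ℂ L), mem_jointSpectrum_iff (Module.finBasis ℂ M),
    character_comp_iff π hπ]
  exact and_congr_right fun _ => not_congr
    ⟨SelfExact.of_retract _ _ π σ (shift_comp π hP f) hσ,
      SelfExact.of_split_central _ _ π σ (shift_comp π hP f) hσ hπz hz hx hχσ hχz⟩

end Quotient

/-- The whole complex is zero. This settles the degenerate case in which one Hilbert space is
trivial and scalars cannot be recovered from operators. -/
theorem jointSpectrum_eq_empty {L : Type*} [LieRing L] [LieAlgebra ℂ L] [FiniteDimensional ℂ L]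
    {H : Type*} [NormedAddCommGroup H] [InnerProductSpace ℂ H] [Subsingleton H]
    (P : L →ₗ⁅ℂ⁆ (H →L[ℂ] H)ᵐᵒᵖ) : jointSpectrum P = ∅ := by
  refine Set.eq_empty_of_forall_notMem fun f hf => ?_
  refine ((mem_jointSpectrum_iff (Module.finBasis ℂ L) P f).mp hf).2 fun t ht => ⟨0, ?_⟩
  rw [map_zero]
  clear ht
  induction t with
  | zero => rfl
  | add s t hs ht => rw [← hs, ← ht, add_zero]
  | tmul e w => rw [Subsingleton.elim e 0, TensorProduct.zero_tmul]

/-! ### Operators with `a ⊗ 1 + 1 ⊗ b = 0`, and scalars in a Lie algebra of operators. -/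

section ScalarOperators

variable {X Y : Type*} [NormedAddCommGroup X] [InnerProductSpace ℂ X]
  [NormedAddCommGroup Y] [InnerProductSpace ℂ Y]

/-- If `a ⊗ 1 + 1 ⊗ b = 0`, then `a` and `b` are opposite scalars. -/
theorem exists_scalar_of_tensorMap_add_eq_zero [Nontrivial X] [Nontrivial Y] {a : X →L[ℂ] X}
    {b : Y →L[ℂ] Y} (h : tensorMap a (.id ℂ Y) + tensorMap (.id ℂ X) b = 0) :
    ∃ c : ℂ, a = c • .id ℂ X ∧ b = -c • .id ℂ Y := by
  have hin : ∀ u x : X, ∀ v y : Y,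
      inner ℂ u (a x) * inner ℂ v y + inner ℂ u x * inner ℂ v (b y) = 0 := fun u x v y => by
    have h1 := congrArg (fun T : HilbertTensor X Y →L[ℂ] HilbertTensor X Y =>
      inner ℂ ((u ⊗ₜ[ℂ] v : X ⊗[ℂ] Y) : HilbertTensor X Y)
        (T ((x ⊗ₜ[ℂ] y : X ⊗[ℂ] Y) : HilbertTensor X Y))) h
    simpa only [_root_.add_apply, _root_.zero_apply, tensorMap_tmul, inner_add_right,
      UniformSpace.Completion.inner_coe, TensorProduct.inner_tmul, inner_zero_right,
      ContinuousLinearMap.id_apply] using h1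
  obtain ⟨x₀, hx₀⟩ := exists_norm_eq X zero_le_one
  obtain ⟨y₀, hy₀⟩ := exists_norm_eq Y zero_le_one
  have hx₁ : inner ℂ x₀ x₀ = (1 : ℂ) := by rw [inner_self_eq_norm_sq_to_K, hx₀]; simp
  have hy₁ : inner ℂ y₀ y₀ = (1 : ℂ) := by rw [inner_self_eq_norm_sq_to_K, hy₀]; simp
  -- Taking matrix coefficients against the unit vector `y₀` in the second factor exhibits `a` as
  -- this scalar; testing against `x₀` then gives `b`.
  have ha : a = -(inner ℂ y₀ (b y₀) : ℂ) • .id ℂ X := by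
    ext x
    refine ext_inner_left ℂ fun u => ?_
    have h1 := hin u x y₀ y₀
    rw [hy₁, mul_one] at h1
    rw [_root_.smul_apply, inner_smul_right, ContinuousLinearMap.id_apply]
    linear_combination h1
  refine ⟨_, ha, ?_⟩
  ext y
  refine ext_inner_left ℂ fun v => ?_
  have h1 := hin x₀ x₀ v y
  rw [ha, _root_.smul_apply, inner_smul_right, ContinuousLinearMap.id_apply, hx₁] at h1
  rw [_root_.smul_apply, inner_smul_right, ContinuousLinearMap.id_apply]
  linear_combination h1

theorem subsingleton_hilbertTensor (h : Subsingleton X ∨ Subsingleton Y) :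
    Subsingleton (HilbertTensor X Y) := by
  have h0 : ContinuousLinearMap.id ℂ (HilbertTensor X Y) = 0 := by
    refine hilbertTensor_ext_tmul fun x y => ?_
    have hxy : x ⊗ₜ[ℂ] y = 0 := by
      rcases h with h | h
      · rw [Subsingleton.elim x 0, TensorProduct.zero_tmul]
      · rw [Subsingleton.elim y 0, TensorProduct.tmul_zero]
    rw [hxy, UniformSpace.Completion.coe_zero, map_zero, map_zero]
  refine subsingleton_of_forall_eq 0 fun t => ?_
  simpa using congrArg (fun T : HilbertTensor X Y →L[ℂ] HilbertTensor X Y => T t) h0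

theorem lie_eq_zero_of_scalar {L : Type*} [LieRing L] [LieAlgebra ℂ L]
    {ρ : L →ₗ⁅ℂ⁆ (X →L[ℂ] X)ᵐᵒᵖ} (hρ : Function.Injective ρ) {x : L} {c : ℂ}
    (hx : (ρ x).unop = c • .id ℂ X) (y : L) : ⁅x, y⁆ = 0 := by
  refine hρ (MulOpposite.unop_injective ?_)
  rw [LieHom.map_lie, LieRing.of_associative_ring_bracket, map_zero, MulOpposite.unop_sub,
    MulOpposite.unop_mul, MulOpposite.unop_mul, hx]
  ext e
  simp

end ScalarOperators

/-! ### From the product Lie algebra to its image as operators. -/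

section OperatorProduct

variable {H H' : Type*} [NormedAddCommGroup H] [InnerProductSpace ℂ H]
  [NormedAddCommGroup H'] [InnerProductSpace ℂ H']
  {L L' M : Type*} [LieRing L] [LieAlgebra ℂ L] [LieRing L'] [LieAlgebra ℂ L']
  [LieRing M] [LieAlgebra ℂ M]
  {ρ : L →ₗ⁅ℂ⁆ (H →L[ℂ] H)ᵐᵒᵖ} {ρ' : L' →ₗ⁅ℂ⁆ (H' →L[ℂ] H')ᵐᵒᵖ}
  {P : L × L' →ₗ⁅ℂ⁆ (HilbertTensor H H' →L[ℂ] HilbertTensor H H')ᵐᵒᵖ}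
  {ρM : M →ₗ⁅ℂ⁆ (HilbertTensor H H' →L[ℂ] HilbertTensor H H')ᵐᵒᵖ} {π : L × L' →ₗ⁅ℂ⁆ M}

theorem exists_scalar_of_product_eq_zero [Nontrivial H] [Nontrivial H']
    (hP : ∀ x, (P (x, 0)).unop = tensorMap (ρ x).unop (.id ℂ H'))
    (hP' : ∀ y, (P (0, y)).unop = tensorMap (.id ℂ H) (ρ' y).unop) {w : L × L'} (hw : P w = 0) :
    ∃ c : ℂ, (ρ w.1).unop = c • .id ℂ H ∧ (ρ' w.2).unop = -c • .id ℂ H' := by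
  refine exists_scalar_of_tensorMap_add_eq_zero ?_
  rw [← hP, ← hP', ← MulOpposite.unop_add, ← map_add, Prod.fst_add_snd, hw, MulOpposite.unop_zero]

variable [FiniteDimensional ℂ L] [FiniteDimensional ℂ L'] [FiniteDimensional ℂ M]

/-- The joint spectrum of the Lie algebra of operators generated by a product, in terms of the joint
spectrum of the product. -/
theorem mem_jointSpectrum_operatorProduct_iff (hρ : Function.Injective ρ)
    (hρ' : Function.Injective ρ')
    (hP : ∀ x, (P (x, 0)).unop = tensorMap (ρ x).unop (.id ℂ H'))
    (hP' : ∀ y, (P (0, y)).unop = tensorMap (.id ℂ H) (ρ' y).unop)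
    (hπ : Function.Surjective π) (hM : ∀ w, P w = ρM (π w)) (f : Module.Dual ℂ M) :
    f ∘ₗ (π : L × L' →ₗ[ℂ] M) ∈ jointSpectrum P ↔ f ∈ jointSpectrum ρM := by
  by_cases hsub : Subsingleton H ∨ Subsingleton H'
  · have := subsingleton_hilbertTensor hsub
    simp only [jointSpectrum_eq_empty, Set.mem_empty_iff_false]
  simp only [not_or, not_subsingleton_iff_nontrivial] at hsub
  obtain ⟨_, _⟩ := hsub
  have hker : ∀ w, π w = 0 → P w = 0 := fun w hw => by rw [hM, hw, map_zero]
  by_cases hinj : ∀ w, π w = 0 → w = 0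
  · exact mem_jointSpectrum_comp_iff_of_bijective π hM
      ⟨(injective_iff_map_eq_zero π).mpr hinj, hπ⟩ f
  obtain ⟨w, hw, hw0⟩ : ∃ w, π w = 0 ∧ w ≠ 0 := by simpa using hinj
  obtain ⟨c, hc, hc'⟩ := exists_scalar_of_product_eq_zero hP hP' (hker w hw)
  have hc0 : c ≠ 0 := by
    rintro rfl
    refine hw0 (Prod.ext (hρ (MulOpposite.unop_injective ?_)) (hρ' (MulOpposite.unop_injective ?_)))
    · rw [hc, zero_smul, Prod.fst_zero, map_zero, MulOpposite.unop_zero]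
    · rw [hc', neg_zero, zero_smul, Prod.snd_zero, map_zero, MulOpposite.unop_zero]
  obtain ⟨z, hπz, hz, hz'⟩ : ∃ z : L × L', π z = 0 ∧ (ρ z.1).unop = (1 : ℂ) • .id ℂ H ∧
      (ρ' z.2).unop = (-1 : ℂ) • .id ℂ H' := by
    -- Rescaling normalizes the kernel element to act as `1` on the first space and `-1` on the
    -- second.
    refine ⟨c⁻¹ • w, by rw [map_smul, hw, smul_zero], ?_, ?_⟩
    · rw [Prod.smul_fst, map_smul, MulOpposite.unop_smul, hc, smul_smul, inv_mul_cancel₀ hc0]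
    · rw [Prod.smul_snd, map_smul, MulOpposite.unop_smul, hc', smul_smul, mul_neg,
        inv_mul_cancel₀ hc0]
  have hspan : ∀ x, π x = 0 → ∃ r : ℂ, x = r • z := fun x hx => by
    obtain ⟨r, hr, hr'⟩ := exists_scalar_of_product_eq_zero hP hP' (hker x hx)
    refine ⟨r, Prod.ext (hρ (MulOpposite.unop_injective ?_))
      (hρ' (MulOpposite.unop_injective ?_))⟩
    · rw [hr, Prod.smul_fst, map_smul, MulOpposite.unop_smul, hz, smul_smul, mul_one]
    · rw [hr', Prod.smul_snd, map_smul, MulOpposite.unop_smul, hz', smul_smul, mul_neg_one]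
  have hcentral : ∀ y : L × L', ⁅z, y⁆ = 0 := fun y =>
    Prod.ext (lie_eq_zero_of_scalar hρ hz y.1) (lie_eq_zero_of_scalar hρ' hz' y.2)
  have hcentral₁ : ∀ y : L × L', ⁅((z.1, 0) : L × L'), y⁆ = 0 := fun y =>
    Prod.ext (lie_eq_zero_of_scalar hρ hz y.1) (zero_lie y.2)
  have hone : (P (z.1, 0)).unop = (1 : ℂ) • .id ℂ (HilbertTensor H H') := by
    rw [hP, hz, tensorMap_smul_left, tensorMap_id]
  -- The splitting character is `(x, y) ↦ f (π (x, 0))`, with value 1 on `z` by assumption.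
  -- Membership in either spectrum supplies that assumption, because `(z.1, 0)` and its image are
  -- central and act as the identity.
  have key : (∀ x y : M, f ⁅x, y⁆ = 0) → f (π (z.1, 0)) = 1 →
      (f ∘ₗ (π : L × L' →ₗ[ℂ] M) ∈ jointSpectrum P ↔ f ∈ jointSpectrum ρM) := fun hf hf1 => by
    refine mem_jointSpectrum_comp_iff_of_split π hM hπ (z := z)
      (χ := (f ∘ₗ (π : L × L' →ₗ[ℂ] M)) ∘ₗ LinearMap.inl ℂ L L' ∘ₗ LinearMap.fst ℂ L L')
      hπz hspan hcentral (fun x y => ?_) hf1 f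
    exact ((character_prod_iff _).mp ((character_comp_iff π hπ f).mpr hf)).1 x.1 y.1
  constructor
  · exact fun h => (key ((character_comp_iff π hπ f).mp h.1)
      (apply_eq_of_mem_jointSpectrum h hcentral₁ hone)).mp h
  · refine fun h => (key h.1 (apply_eq_of_mem_jointSpectrum h (fun y => ?_)
      (by rw [← hM, hone]))).mpr h
    obtain ⟨y, rfl⟩ := hπ y
    rw [← LieHom.map_lie, hcentral₁, map_zero]

/-- An element of the kernel of `π` is a pair of opposite scalars on nonzero spaces, hence central
and acting as zero. A spectral point vanishes on it and so factors through `M`. -/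
theorem exists_comp_eq_of_mem_jointSpectrum (hρ : Function.Injective ρ)
    (hρ' : Function.Injective ρ')
    (hP : ∀ x, (P (x, 0)).unop = tensorMap (ρ x).unop (.id ℂ H'))
    (hP' : ∀ y, (P (0, y)).unop = tensorMap (.id ℂ H) (ρ' y).unop)
    (hπ : Function.Surjective π) (hM : ∀ w, P w = ρM (π w)) {g : Module.Dual ℂ (L × L')}
    (hg : g ∈ jointSpectrum P) : ∃ f : Module.Dual ℂ M, f ∘ₗ (π : L × L' →ₗ[ℂ] M) = g := by
  by_cases hsub : Subsingleton H ∨ Subsingleton H'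
  · have := subsingleton_hilbertTensor hsub
    rw [jointSpectrum_eq_empty] at hg
    exact hg.elim
  simp only [not_or, not_subsingleton_iff_nontrivial] at hsub
  obtain ⟨_, _⟩ := hsub
  obtain ⟨s, hs⟩ := LinearMap.exists_rightInverse_of_surjective (π : L × L' →ₗ[ℂ] M)
    (LinearMap.range_eq_top.mpr hπ)
  refine ⟨g ∘ₗ s, LinearMap.ext fun w => sub_eq_zero.mp ?_⟩
  have hw : π (s (π w) - w) = 0 := by
    rw [map_sub, sub_eq_zero]
    exact LinearMap.congr_fun hs (π w)
  have hPw : P (s (π w) - w) = 0 := by rw [hM, hw, map_zero]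
  obtain ⟨c, hc, hc'⟩ := exists_scalar_of_product_eq_zero hP hP' hPw
  refine (map_sub g _ _).symm.trans (apply_eq_of_mem_jointSpectrum hg (fun y => ?_) ?_)
  · exact Prod.ext (lie_eq_zero_of_scalar hρ hc y.1) (lie_eq_zero_of_scalar hρ' hc' y.2)
  · exact (congrArg MulOpposite.unop hPw).trans (zero_smul ℂ _).symm

end OperatorProduct

/-! ### The spectrum of the operator algebra `{x ⊗ 1 + 1 ⊗ y}`. -/

section ProductAlgebra

variable {H₁ H₂ : Type*} [NormedAddCommGroup H₁] [InnerProductSpace ℂ H₁]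
  [NormedAddCommGroup H₂] [InnerProductSpace ℂ H₂]
  (L₁ : LieSubalgebra ℂ (H₁ →L[ℂ] H₁)ᵐᵒᵖ) (L₂ : LieSubalgebra ℂ (H₂ →L[ℂ] H₂)ᵐᵒᵖ)

/-- The surjection of `L₁ × L₂` onto the Lie algebra of operators `{x ⊗ 1 + 1 ⊗ y}`. -/
def toProductAlgebra : L₁ × L₂ →ₗ⁅ℂ⁆ productAlgebra L₁ L₂ := (productAction L₁ L₂).rangeRestrict

theorem toProductAlgebra_surjective : Function.Surjective (toProductAlgebra L₁ L₂) :=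
  (productAction L₁ L₂).surjective_rangeRestrict

variable [FiniteDimensional ℂ L₁] [FiniteDimensional ℂ L₂]

theorem finiteDimensional_productAlgebra : FiniteDimensional ℂ (productAlgebra L₁ L₂) :=
  Module.Finite.of_surjective (toProductAlgebra L₁ L₂ : L₁ × L₂ →ₗ[ℂ] productAlgebra L₁ L₂)
    (toProductAlgebra_surjective L₁ L₂)

theorem mem_Sp_productAlgebra_iff (f : Module.Dual ℂ (productAlgebra L₁ L₂)) :
    f ∘ₗ (toProductAlgebra L₁ L₂ : L₁ × L₂ →ₗ[ℂ] productAlgebra L₁ L₂) ∈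
      jointSpectrum (productAction L₁ L₂) ↔ f ∈ Sp (productAlgebra L₁ L₂) :=
  have := finiteDimensional_productAlgebra L₁ L₂
  mem_jointSpectrum_operatorProduct_iff (ρ := L₁.incl) (ρ' := L₂.incl) Subtype.val_injective
    Subtype.val_injective (productAction_inl L₁ L₂) (productAction_inr L₁ L₂)
    (toProductAlgebra_surjective L₁ L₂) (fun _ => rfl) f

theorem exists_comp_toProductAlgebra_eq {g : Module.Dual ℂ (L₁ × L₂)}
    (hg : g ∈ jointSpectrum (productAction L₁ L₂)) :
    ∃ f : Module.Dual ℂ (productAlgebra L₁ L₂),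
      f ∘ₗ (toProductAlgebra L₁ L₂ : L₁ × L₂ →ₗ[ℂ] productAlgebra L₁ L₂) = g :=
  have := finiteDimensional_productAlgebra L₁ L₂
  exists_comp_eq_of_mem_jointSpectrum (ρ := L₁.incl) (ρ' := L₂.incl)
    (ρM := (productAlgebra L₁ L₂).incl) Subtype.val_injective
    Subtype.val_injective (productAction_inl L₁ L₂) (productAction_inr L₁ L₂)
    (toProductAlgebra_surjective L₁ L₂) (fun _ => rfl) hg

theorem image_jointSpectrum_productAction [CompleteSpace H₁] [CompleteSpace H₂] :
    (fun f : Module.Dual ℂ (L₁ × L₂) => (f ∘ₗ LinearMap.inl ℂ L₁ L₂, f ∘ₗ LinearMap.inr ℂ L₁ L₂)) ''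
      jointSpectrum (productAction L₁ L₂) = Sp L₁ ×ˢ Sp L₂ := by
  ext ⟨f₁, f₂⟩
  constructor
  · rintro ⟨f, hf, h⟩
    rw [← h]
    exact (mem_jointSpectrum_productAction_iff L₁ L₂ f).mp hf
  · intro h
    refine ⟨LinearMap.coprod f₁ f₂, (mem_jointSpectrum_productAction_iff L₁ L₂ _).mpr ?_,
      Prod.ext (LinearMap.coprod_inl f₁ f₂) (LinearMap.coprod_inr f₁ f₂)⟩
    rw [LinearMap.coprod_inl, LinearMap.coprod_inr]
    exact h

/-- Composition with `toProductAlgebra` matches the two spectra: it preserves and reflects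
membership, and every spectral point of the product factors through it. -/
theorem image_Sp_productAlgebra :
    (fun f : Module.Dual ℂ (productAlgebra L₁ L₂) =>
      (f ∘ₗ inclLeft L₁ L₂, f ∘ₗ inclRight L₁ L₂)) '' Sp (productAlgebra L₁ L₂) =
    (fun f : Module.Dual ℂ (L₁ × L₂) => (f ∘ₗ LinearMap.inl ℂ L₁ L₂, f ∘ₗ LinearMap.inr ℂ L₁ L₂)) ''
      jointSpectrum (productAction L₁ L₂) := by
  ext p
  constructor
  · rintro ⟨f, hf, rfl⟩
    exact ⟨_, (mem_Sp_productAlgebra_iff L₁ L₂ f).mpr hf, rfl⟩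
  · rintro ⟨g, hg, rfl⟩
    obtain ⟨f, rfl⟩ := exists_comp_toProductAlgebra_eq L₁ L₂ hg
    exact ⟨f, (mem_Sp_productAlgebra_iff L₁ L₂ f).mp hg, rfl⟩

end ProductAlgebra

end LieSpectrum

end

theorem mainTheorem1
    {H₁ H₂ : Type*}
    [NormedAddCommGroup H₁] [InnerProductSpace ℂ H₁] [CompleteSpace H₁]
    [NormedAddCommGroup H₂] [InnerProductSpace ℂ H₂] [CompleteSpace H₂]
    (L₁ : LieSubalgebra ℂ (H₁ →L[ℂ] H₁)ᵐᵒᵖ) (L₂ : LieSubalgebra ℂ (H₂ →L[ℂ] H₂)ᵐᵒᵖ)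
    [FiniteDimensional ℂ L₁] [FiniteDimensional ℂ L₂]
    [LieAlgebra.IsSolvable L₁] [LieAlgebra.IsSolvable L₂] :
    (fun f : Module.Dual ℂ (L₁ × L₂) =>
        (f ∘ₗ LinearMap.inl ℂ L₁ L₂, f ∘ₗ LinearMap.inr ℂ L₁ L₂)) ''
        LieSpectrum.jointSpectrum (LieSpectrum.productAction L₁ L₂) =
      LieSpectrum.Sp L₁ ×ˢ LieSpectrum.Sp L₂ ∧
    (fun f : Module.Dual ℂ (LieSpectrum.productAlgebra L₁ L₂) =>
        (f ∘ₗ LieSpectrum.inclLeft L₁ L₂, f ∘ₗ LieSpectrum.inclRight L₁ L₂)) ''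
        LieSpectrum.Sp (LieSpectrum.productAlgebra L₁ L₂) =
      LieSpectrum.Sp L₁ ×ˢ LieSpectrum.Sp L₂ :=
  ⟨LieSpectrum.image_jointSpectrum_productAction L₁ L₂,
    (LieSpectrum.image_Sp_productAlgebra L₁ L₂).trans
      (LieSpectrum.image_jointSpectrum_productAction L₁ L₂)⟩
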